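/- Graphs are simplicial, and $d$ denotes the graph distance. A connected graph $X$ is \emph{quasi-median} if it contains neither $K_4^-$ (the complete graph $K_4$ minus one edge) nor $K_{3,2}$ as an induced subgraph, and if it satisfies: (triangle condition) for all vertices $a,x,y$ with $x,y$ adjacent and $d(a,x)=d(a,y)$, there is a vertex $z$ adjacent to $x$ and $y$ with $d(a,z)=d(a,x)-1$; (quadrangle condition) for all vertices $a,x,y,z$ with $x\neq y$, $z$ adjacent to both $x$ and $y$, and $d(a,x)=d(a,y)=d(a,z)-1$, there is a vertex $w$ adjacent to $x$ and $y$ with $d(a,w)=d(a,z)-2$. A \emph{hyperplane} of $X$ is a class of edges for the equivalence relation generated by identifying two edges that lie in a common triangle or are opposite sides of a square (an induced 4-cycle). Its \emph{carrier} $N(J)$ is the subgraph generated by the edges of $J$; its \emph{sectors} are the connected components of the graph obtained from $X$ by removing the interiors of the edges of $J$, and $\mathscr{S}(J)$ is the set of sectors. Two hyperplanes $J_1,J_2$ are \emph{transverse} if some edges $e_1\in J_1$ and $e_2\in J_2$ are adjacent sides of a square, and \emph{tangent} if they are distinct, not transverse, and $N(J_1)\cap N(J_2)\neq\emptyset$.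 Let a group $G$ act faithfully on $X$ by graph automorphisms. The action is \emph{special} if: (i) for every hyperplane $J$ and every $g\in G$, $J$ and $gJ$ are neither transverse nor tangent; (ii) for all hyperplanes $J_1,J_2$ and every $g\in G$, if $J_1$ and $J_2$ are transverse then $J_1$ and $gJ_2$ are not tangent; (iii) for every hyperplane $J$, the image $\mathfrak{S}(J)$ of $\mathrm{stab}_G(J)$ in the permutation group of $\mathscr{S}(J)$ acts freely on $\mathscr{S}(J)$. A subgraph $Y\subset X$ is \emph{gated} if for every vertex $x$ of $X$ there is a vertex $y\in Y$ such that, for every vertex $z\in Y$, some geodesic of $X$ between $x$ and $z$ passes through $y$. A subgroup $H\le G$ is \emph{gated-cocompact} if there is an $H$-invariant gated subgraph $Y\subset X$ on which $H$ acts with finitely many orbits of vertices. A subgroup $H\le G$ is a \emph{virtual retract} of $G$ if there are a finite-index subgroup $K\le G$ containing $H$ and a morphism $r:K\to H$ with $r|_H=\mathrm{Id}_H$. \textbf{Corollary.} Let $G$ be a group which acts specially on a quasi-median graph $X$ with finitely many orbits of vertices. Then every gated-cocompact subgroup of $G$ (with respect to its action on $X$) is a virtual retract of $G$. -/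

import Mathlib

namespace QuasiMedian

variable {V : Type*}

/-- `K₄⁻`: the complete graph on four vertices minus one edge. -/
def K4Minus : SimpleGraph (Fin 4) :=
  (⊤ : SimpleGraph (Fin 4)).deleteEdges {s(0, 1)}

/-- `K₃,₂`: the complete bipartite graph on `3 + 2` vertices. -/
abbrev K32 : SimpleGraph (Fin 3 ⊕ Fin 2) := completeBipartiteGraph (Fin 3) (Fin 2)

/-- Quasi-median graphs. A graph embedding `K ↪g X` is exactly a copy of `K` in `X` as an
*induced* subgraph; connected graphs are non-empty. -/
structure IsQuasiMedian (X : SimpleGraph V) : Prop where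
  connected : X.Connected
  no_K4Minus : IsEmpty (K4Minus ↪g X)
  no_K32 : IsEmpty (K32 ↪g X)
  triangle : ∀ a x y : V, X.Adj x y → X.dist a x = X.dist a y →
    ∃ z : V, X.Adj z x ∧ X.Adj z y ∧ X.dist a z + 1 = X.dist a x
  quadrangle : ∀ a x y z : V, x ≠ y → X.Adj z x → X.Adj z y →
    X.dist a x = X.dist a y → X.dist a x + 1 = X.dist a z →
    ∃ w : V, X.Adj w x ∧ X.Adj w y ∧ X.dist a w + 2 = X.dist a z

/-- `y` is a gate of `x` in `Y`: `y ∈ Y`, and for every `z ∈ Y` some geodesic of `X` between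
`x` and `z` passes through `y`. -/
def IsGate (X : SimpleGraph V) (Y : Set V) (x y : V) : Prop :=
  y ∈ Y ∧ ∀ z ∈ Y, ∃ p : X.Walk x z, p.length = X.dist x z ∧ y ∈ p.support

/-- (The subgraph induced by) `Y` is gated: every vertex has a gate in `Y`. Gatedness of a
subgraph depends only on its vertex-set. -/
def IsGated (X : SimpleGraph V) (Y : Set V) : Prop :=
  ∀ x : V, ∃ y : V, IsGate X Y x y

/-! ### Hyperplanes and sectors -/

/-- `a, b, c, d` are, in this cyclic order, the vertices of a square, i.e. of an induced
4-cycle. -/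
structure IsSquare (X : SimpleGraph V) (a b c d : V) : Prop where
  ab : X.Adj a b
  bc : X.Adj b c
  cd : X.Adj c d
  da : X.Adj d a
  ne_ac : a ≠ c
  ne_bd : b ≠ d
  not_ac : ¬ X.Adj a c
  not_bd : ¬ X.Adj b d

/-- The edges `e` and `f` are two sides of a triangle, or opposite sides of a square. -/
def Parallel (X : SimpleGraph V) (e f : X.edgeSet) : Prop :=
  (∃ a b c : V, X.Adj a b ∧ X.Adj b c ∧ X.Adj a c ∧ e.1 = s(a, b) ∧ f.1 = s(b, c)) ∨
  (∃ a b c d : V, IsSquare X a b c d ∧ e.1 = s(a, b) ∧ f.1 = s(d, c))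

/-- The equivalence relation on edges generated by `Parallel`. -/
def hyperplaneSetoid (X : SimpleGraph V) : Setoid X.edgeSet :=
  Relation.EqvGen.setoid (Parallel X)

/-- Hyperplanes: equivalence classes of edges. -/
def Hyperplane (X : SimpleGraph V) : Type _ := Quotient (hyperplaneSetoid X)

/-- The hyperplane dual to an edge. -/
def Hyperplane.mk {X : SimpleGraph V} (e : X.edgeSet) : Hyperplane X :=
  Quotient.mk (hyperplaneSetoid X) e

/-- The edges dual to `J`. -/
def Hyperplane.edges {X : SimpleGraph V} (J : Hyperplane X) : Set (Sym2 V) :=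
  {e | ∃ he : e ∈ X.edgeSet, Hyperplane.mk ⟨e, he⟩ = J}

/-- The vertices of the carrier `N(J)`: the endpoints of the edges dual to `J`. -/
def Hyperplane.carrier {X : SimpleGraph V} (J : Hyperplane X) : Set V :=
  {v | ∃ e ∈ J.edges, v ∈ e}

/-- Sectors delimited by `J`: connected components of the graph obtained from `X` by removing
the interiors of the edges dual to `J`. -/
def Hyperplane.Sector {X : SimpleGraph V} (J : Hyperplane X) : Type _ :=
  (X.deleteEdges J.edges).ConnectedComponent

/-- `J₁` and `J₂` are transverse: some square has a side in `J₁` and an adjacent side in `J₂`. -/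
def Hyperplane.Transverse {X : SimpleGraph V} (J₁ J₂ : Hyperplane X) : Prop :=
  ∃ a b c d : V, IsSquare X a b c d ∧ s(a, b) ∈ J₁.edges ∧ s(a, d) ∈ J₂.edges

/-- `J₁` and `J₂` are tangent: distinct, not transverse, with intersecting carriers. -/
def Hyperplane.Tangent {X : SimpleGraph V} (J₁ J₂ : Hyperplane X) : Prop :=
  J₁ ≠ J₂ ∧ ¬ J₁.Transverse J₂ ∧ (J₁.carrier ∩ J₂.carrier).Nonempty

/-! ### Group actions on graphs -/

/-- The action of `G` on the vertices of `X` is an action by graph automorphisms. -/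
class IsGraphAction (G : Type*) [Group G] [MulAction G V] (X : SimpleGraph V) : Prop where
  adj_smul : ∀ (g : G) {x y : V}, X.Adj x y → X.Adj (g • x) (g • y)

section Action

variable {G : Type*} [Group G] [MulAction G V] {X : SimpleGraph V} [IsGraphAction G X]

theorem adj_smul_iff (g : G) {x y : V} : X.Adj (g • x) (g • y) ↔ X.Adj x y := by
  refine ⟨fun h => ?_, IsGraphAction.adj_smul g⟩
  simpa using IsGraphAction.adj_smul (X := X) g⁻¹ h

/-- The induced action on edges. -/
def smulEdge (g : G) (e : X.edgeSet) : X.edgeSet :=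
  ⟨e.1.map (g • ·), by
    obtain ⟨e, he⟩ := e
    induction e using Sym2.ind with
    | _ x y => exact IsGraphAction.adj_smul (X := X) g he⟩

theorem IsSquare.smul (g : G) {a b c d : V} (h : IsSquare X a b c d) :
    IsSquare X (g • a) (g • b) (g • c) (g • d) where
  ab := IsGraphAction.adj_smul g h.ab
  bc := IsGraphAction.adj_smul g h.bc
  cd := IsGraphAction.adj_smul g h.cd
  da := IsGraphAction.adj_smul g h.da
  ne_ac := fun e => h.ne_ac (MulAction.injective g e)
  ne_bd := fun e => h.ne_bd (MulAction.injective g e)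
  not_ac := fun e => h.not_ac ((adj_smul_iff g).1 e)
  not_bd := fun e => h.not_bd ((adj_smul_iff g).1 e)

theorem Parallel.smul (g : G) {e f : X.edgeSet} (h : Parallel X e f) :
    Parallel X (smulEdge g e) (smulEdge g f) := by
  rcases h with ⟨a, b, c, hab, hbc, hac, he, hf⟩ | ⟨a, b, c, d, hs, he, hf⟩
  · exact Or.inl ⟨g • a, g • b, g • c, IsGraphAction.adj_smul g hab,
      IsGraphAction.adj_smul g hbc, IsGraphAction.adj_smul g hac,
      by simp [smulEdge, he], by simp [smulEdge, hf]⟩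
  · exact Or.inr ⟨g • a, g • b, g • c, g • d, hs.smul g,
      by simp [smulEdge, he], by simp [smulEdge, hf]⟩

theorem eqvGen_smul (g : G) {e f : X.edgeSet} (h : Relation.EqvGen (Parallel X) e f) :
    Relation.EqvGen (Parallel X) (smulEdge g e) (smulEdge g f) := by
  induction h with
  | rel _ _ h => exact .rel _ _ (h.smul g)
  | refl _ => exact .refl _
  | symm _ _ _ ih => exact .symm _ _ ih
  | trans _ _ _ _ _ ih₁ ih₂ => exact .trans _ _ _ ih₁ ih₂

/-- The induced action on hyperplanes. -/
instance : MulAction G (Hyperplane X) where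
  smul g J := Quotient.map (sa := hyperplaneSetoid X) (sb := hyperplaneSetoid X)
    (smulEdge g) (fun _ _ h => eqvGen_smul g h) J
  one_smul J := by
    induction J using Quotient.ind with
    | _ e =>
      refine congrArg (Quotient.mk (hyperplaneSetoid X)) (Subtype.ext ?_)
      simp [smulEdge]
  mul_smul g h J := by
    induction J using Quotient.ind with
    | _ e =>
      refine congrArg (Quotient.mk (hyperplaneSetoid X)) (Subtype.ext ?_)
      simp [smulEdge, Sym2.map_map, mul_smul]

theorem smul_mk (g : G) (e : X.edgeSet) :
    g • Hyperplane.mk e = Hyperplane.mk (smulEdge g e) := rfl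

theorem mem_edges_of_smul {J : Hyperplane X} (g : MulAction.stabilizer G J) {x y : V}
    (h : s(g • x, g • y) ∈ J.edges) : s(x, y) ∈ J.edges := by
  obtain ⟨he, hJ⟩ := h
  have hxy : s(x, y) ∈ X.edgeSet := (adj_smul_iff (g : G)).1 he
  refine ⟨hxy, ?_⟩
  have h₁ : (g : G) • Hyperplane.mk (⟨s(x, y), hxy⟩ : X.edgeSet) = J := by
    exact hJ
  rw [eq_inv_smul_iff.2 h₁]
  exact (MulAction.stabilizer G J).inv_mem g.2

/-- The automorphism of `X` cut along `J` induced by an element of `stab(J)`. -/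
def cutHom (J : Hyperplane X) (g : MulAction.stabilizer G J) :
    X.deleteEdges J.edges →g X.deleteEdges J.edges where
  toFun x := g • x
  map_rel' := by
    intro x y h
    rw [SimpleGraph.deleteEdges_adj] at h ⊢
    exact ⟨IsGraphAction.adj_smul (g : G) h.1, fun h' => h.2 (mem_edges_of_smul g h')⟩

/-- The induced action of `stab(J)` on the sectors delimited by `J`. -/
instance (J : Hyperplane X) : MulAction (MulAction.stabilizer G J) J.Sector where
  smul g S := SimpleGraph.ConnectedComponent.map (cutHom J g) S
  one_smul S := by
    induction S using SimpleGraph.ConnectedComponent.ind with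
    | _ v => exact congrArg _ (one_smul (MulAction.stabilizer G J) v)
  mul_smul g h S := by
    induction S using SimpleGraph.ConnectedComponent.ind with
    | _ v => exact congrArg _ (mul_smul g h v)

variable (G) in
/-- `𝔖(J)`: the image of `stab(J)` in the permutation group of the sectors of `J`. -/
def sectorGroup (J : Hyperplane X) : Subgroup (Equiv.Perm J.Sector) :=
  (MulAction.toPermHom (MulAction.stabilizer G J) J.Sector).range

variable (G X) in
/-- The (faithful) action of `G` on `X` is hyperplane-special. -/
structure IsHyperplaneSpecial : Prop where
  faithful : FaithfulSMul G V
  not_transverse : ∀ (J : Hyperplane X) (g : G), ¬ J.Transverse (g • J)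
  not_tangent : ∀ (J : Hyperplane X) (g : G), ¬ J.Tangent (g • J)
  not_inter_osculating : ∀ (J₁ J₂ : Hyperplane X) (g : G),
    J₁.Transverse J₂ → ¬ J₁.Tangent (g • J₂)

variable (G X) in
/-- The action of `G` on `X` is special: hyperplane-special, with `𝔖(J)` acting freely on the
set of sectors of `J` for every hyperplane `J`. -/
structure IsSpecial : Prop extends IsHyperplaneSpecial G X where
  free : ∀ (J : Hyperplane X) (σ : Equiv.Perm J.Sector), σ ∈ sectorGroup G J →
    ∀ S : J.Sector, σ S = S → σ = 1

end Action

/-- `H ≤ G` is gated-cocompact: it preserves some gated subgraph of `X`, on which it acts with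
finitely many orbits of vertices. -/
def IsGatedCocompact {G : Type*} [Group G] [MulAction G V] (X : SimpleGraph V)
    (H : Subgroup G) : Prop :=
  ∃ Y : SubMulAction H V, IsGated X (Y : Set V) ∧ Finite (MulAction.orbitRel.Quotient H Y)

/-- `H` is a virtual retract of `G`: some finite-index subgroup `K` of `G` contains `H` and
retracts onto `H`. -/
def IsVirtualRetract {G : Type*} [Group G] (H : Subgroup G) : Prop :=
  ∃ (K : Subgroup G) (hHK : H ≤ K), K.FiniteIndex ∧
    ∃ r : K →* H, ∀ h : H, r (Subgroup.inclusion hHK h) = h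

end QuasiMedian

namespace QuasiMedian

/-! ### Distances, gates of cliques, and the square lemma -/

section Geometry

variable {V : Type*} {X : SimpleGraph V}

/-! The idea is a canonical completion in the style of Haglund and Wise: the partial motions inside
the gated subgraph `Y` are extended to a right action of all of `G` on `Y` commuting with `H`.

Each orbit of hyperplanes carries a group structure on the sectors of a representative, for which
stabilisers act by translations; this is where freeness of `𝔖(J)` enters. Every pair of vertices
thus gets a `G`-invariant label relative to each hyperplane (`IsSpecial.exists_labelling`). An
oriented edge of `X` dual to `J` acts on `Y` by moving `y` with the same label across the hyperplane
of `G • J` dual to an edge of `Y` at `y`, and by fixing `y` if there is none. Such a hyperplane is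
unique because translates are neither transverse nor tangent. The motions compose along triangles
(`move_move`) and commute along squares (`move_comm`), the latter because hyperplanes from two
orbits with a transverse pair are transverse as soon as their carriers meet.

Filling triangles and squares makes `X` simply connected, so these permutations integrate to a
potential `F : V → Perm Y` (`IsQuasiMedian.exists_potential`). Invariance of the labels makes `g ↦ F
(g • x₀)` an antihomomorphism, and `F z` sends `x₀` to `z` for `z` in `Y`. The elements sending `x₀`
into its own `H`-orbit form a subgroup `K`, of finite index because `Y` has finitely many
`H`-orbits. Since `H` acts freely, comparing the image of `x₀` with `H • x₀` defines the retraction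
(`isVirtualRetract_of_perm`).

The geometric input is that a hyperplane is governed by any of its maximal cliques: its edges are
those whose ends project to different vertices of the clique, and its sectors are the fibres of the
projection (`IsMaxClique.mem_edges_iff`, `IsMaxClique.sectorOf_eq_iff`). This rests on the
modularity of distances on squares (`IsSquare.dist_add_dist`). -/

theorem IsQuasiMedian.dist_le_succ (hX : IsQuasiMedian X) {u v : V} (h : X.Adj u v) (a : V) :
    X.dist a v ≤ X.dist a u + 1 := by
  have h₁ := hX.connected.dist_triangle (u := a) (v := u) (w := v)
  rwa [SimpleGraph.dist_eq_one_iff_adj.2 h] at h₁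

theorem IsQuasiMedian.exists_adj_dist (hX : IsQuasiMedian X) {a u : V} (h : a ≠ u) :
    ∃ w, X.Adj w u ∧ X.dist a w + 1 = X.dist a u := by
  obtain ⟨p, hp⟩ := hX.connected.exists_walk_length_eq_dist u a
  cases p with
  | nil => exact absurd rfl h
  | @cons _ w _ hw q =>
    refine ⟨w, hw.symm, ?_⟩
    have h₁ := SimpleGraph.dist_le q
    have h₂ := hX.dist_le_succ hw.symm a
    rw [SimpleGraph.Walk.length_cons, SimpleGraph.dist_comm] at hp
    rw [SimpleGraph.dist_comm] at h₁
    omega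

theorem IsQuasiMedian.adj_of_common (hX : IsQuasiMedian X) {a b x y : V} (hxy : X.Adj x y)
    (hax : X.Adj a x) (hay : X.Adj a y) (hbx : X.Adj b x) (hby : X.Adj b y) (hab : a ≠ b) :
    X.Adj a b := by
  by_contra hn
  refine hX.no_K4Minus.false ⟨⟨![a, b, x, y], ?_⟩, ?_⟩
  · intro i j h
    have := hax.ne; have := hay.ne; have := hbx.ne; have := hby.ne; have := hxy.ne
    fin_cases i <;> fin_cases j <;> simp_all
  · intro i j
    change X.Adj (![a, b, x, y] i) (![a, b, x, y] j) ↔ _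
    have hn' : ¬ X.Adj b a := fun h => hn h.symm
    have := hax.symm; have := hay.symm; have := hbx.symm; have := hby.symm; have := hxy.symm
    fin_cases i <;> fin_cases j <;> simp_all [K4Minus]

theorem IsQuasiMedian.no_three_common (hX : IsQuasiMedian X) {a b c x y : V} (hxy : x ≠ y)
    (hnxy : ¬ X.Adj x y)
    (hax : X.Adj a x) (hay : X.Adj a y) (hbx : X.Adj b x) (hby : X.Adj b y)
    (hcx : X.Adj c x) (hcy : X.Adj c y) (hab : a ≠ b) (hac : a ≠ c) (hbc : b ≠ c) : False := by
  have key : ∀ {p q : V}, X.Adj p x → X.Adj p y → X.Adj q x → X.Adj q y → ¬ X.Adj p q :=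
    fun {p q} h₁ h₂ h₃ h₄ h =>
      hnxy (hX.adj_of_common h h₁.symm h₃.symm h₂.symm h₄.symm hxy)
  refine hX.no_K32.false ⟨⟨Sum.elim ![a, b, c] ![x, y], ?_⟩, ?_⟩
  · intro i j h
    have := hax.ne; have := hay.ne; have := hbx.ne; have := hby.ne; have := hcx.ne
    have := hcy.ne
    rcases i with i | i <;> rcases j with j | j <;> fin_cases i <;> fin_cases j <;> simp_all
  · intro i j
    change X.Adj (Sum.elim ![a, b, c] ![x, y] i) (Sum.elim ![a, b, c] ![x, y] j) ↔ _
    have h₁ := key hax hay hbx hby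
    have h₂ := key hax hay hcx hcy
    have h₃ := key hbx hby hcx hcy
    have h₁' : ¬ X.Adj b a := fun h => h₁ h.symm
    have h₂' : ¬ X.Adj c a := fun h => h₂ h.symm
    have h₃' : ¬ X.Adj c b := fun h => h₃ h.symm
    have h₄' : ¬ X.Adj y x := fun h => hnxy h.symm
    have := hax.symm; have := hay.symm; have := hbx.symm; have := hby.symm
    have := hcx.symm; have := hcy.symm
    clear key
    rcases i with i | i <;> rcases j with j | j <;> fin_cases i <;> fin_cases j <;> simp_all

theorem IsSquare.rotate {a b c d : V} (h : IsSquare X a b c d) : IsSquare X b c d a :=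
  ⟨h.bc, h.cd, h.da, h.ab, h.ne_bd, h.ne_ac.symm, h.not_bd, fun e => h.not_ac e.symm⟩

theorem IsSquare.reflect {a b c d : V} (h : IsSquare X a b c d) : IsSquare X a d c b :=
  ⟨h.da.symm, h.cd.symm, h.bc.symm, h.ab.symm, h.ne_ac, h.ne_bd.symm, h.not_ac,
    fun e => h.not_bd e.symm⟩

/-- The quadrangle condition at `p`, `r` gives a common neighbour closer to `a` than both; with `q`
and `s` it completes an induced `K32`. -/
theorem IsSquare.not_alternating (hX : IsQuasiMedian X) {p q r s : V} (h : IsSquare X p q r s)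
    (a : V) : ¬ (X.dist a q = X.dist a p + 1 ∧ X.dist a r = X.dist a p ∧
    X.dist a s = X.dist a p + 1) := by
  rintro ⟨h₁, h₂, h₃⟩
  obtain ⟨w, hwp, hwr, hw⟩ :=
    hX.quadrangle a p r q h.ne_ac h.ab.symm h.bc h₂.symm h₁.symm
  have hwq : w ≠ q := by rintro rfl; omega
  have hws : w ≠ s := by rintro rfl; omega
  exact hX.no_three_common h.ne_ac h.not_ac hwp hwr h.ab.symm h.bc h.da h.cd.symm hwq hws h.ne_bd

theorem IsSquare.not_one_far (hX : IsQuasiMedian X) {p q r s : V} (h : IsSquare X p q r s)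
    (a : V) : ¬ (X.dist a q = X.dist a p ∧ X.dist a r = X.dist a p ∧
    X.dist a s = X.dist a p + 1) := by
  rintro ⟨h₁, h₂, h₃⟩
  obtain ⟨w, hwp, hwr, hw⟩ :=
    hX.quadrangle a p r s h.ne_ac h.da h.cd.symm h₂.symm h₃.symm
  have hwq : w ≠ q := by rintro rfl; omega
  have hws : w ≠ s := by rintro rfl; omega
  exact hX.no_three_common h.ne_ac h.not_ac hwp hwr h.ab.symm h.bc h.da h.cd.symm hwq hws h.ne_bd

/-- The adjacent vertices `a` and `z'` are both at distance 2 from `q`, so the triangle condition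
gives a common neighbour `t` of `a`, `z'` and `q`. Then `t`, `p`, `z` are three common neighbours of
the non-adjacent vertices `a` and `q`. -/
theorem IsSquare.not_one_near_one (hX : IsQuasiMedian X) {p q r s a z' : V}
    (h : IsSquare X p q r s) {z : V} (hap : X.Adj a p) (haz : X.Adj a z) (hzq : X.Adj z q)
    (hzp : z ≠ p) (haz' : X.Adj a z') (hz'r : X.Adj z' r)
    (hz'q : ¬ X.Adj z' q) (hpz : ¬ X.Adj p z) (hz'p : ¬ X.Adj p z') (hzz' : ¬ X.Adj z z')
    (haq : ¬ X.Adj a q) (haq' : a ≠ q) (hz'q' : z' ≠ q) : False := by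
  have d₁ : X.dist q a = 2 := by
    have h₁ : 1 < X.dist q a :=
      hX.connected.one_lt_dist_of_ne_of_not_adj haq'.symm (fun e => haq e.symm)
    have h₂ := hX.dist_le_succ hap.symm q
    rw [SimpleGraph.dist_eq_one_iff_adj.2 h.ab.symm] at h₂
    omega
  have d₂ : X.dist q z' = 2 := by
    have h₁ : 1 < X.dist q z' :=
      hX.connected.one_lt_dist_of_ne_of_not_adj hz'q'.symm (fun e => hz'q e.symm)
    have h₂ := hX.dist_le_succ hz'r.symm q
    rw [SimpleGraph.dist_eq_one_iff_adj.2 h.bc] at h₂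
    omega
  obtain ⟨t, hta, htz', ht⟩ := hX.triangle q a z' haz' (d₁.trans d₂.symm)
  have htq : X.Adj q t := SimpleGraph.dist_eq_one_iff_adj.1 (by omega)
  refine hX.no_three_common haq' haq hta htq.symm hap.symm h.ab haz.symm hzq ?_ ?_ hzp.symm
  · rintro rfl; exact hz'p htz'
  · rintro rfl; exact hzz' htz'

theorem IsSquare.not_one_near (hX : IsQuasiMedian X) {p q r s : V} (h : IsSquare X p q r s)
    (a : V) : ¬ (X.dist a q = X.dist a p + 1 ∧ X.dist a r = X.dist a p + 1 ∧
    X.dist a s = X.dist a p + 1) := by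
  rintro ⟨h₁, h₂, h₃⟩
  -- any two vertices with two adjacent common neighbours are adjacent
  have key : ∀ {b c x y : V}, b ≠ c → ¬ X.Adj b c → X.Adj x y → X.Adj x b → X.Adj x c →
      X.Adj y b → X.Adj y c → False := fun hbc hn hxy h₁ h₂ h₃ h₄ =>
    hn (hX.adj_of_common hxy h₁.symm h₃.symm h₂.symm h₄.symm hbc)
  obtain ⟨z, hzq, hzr, hz⟩ := hX.triangle a q r h.bc (by omega)
  obtain ⟨z', hz'r, hz's, hz'⟩ := hX.triangle a r s h.cd (by omega)
  have hzs : ¬ X.Adj z s := fun e => key h.ne_bd h.not_bd hzr hzq e h.bc.symm h.cd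
  have hz'q : ¬ X.Adj z' q := fun e => key h.ne_bd h.not_bd hz'r e hz's h.bc.symm h.cd
  have hzp : z ≠ p := by rintro rfl; exact h.not_ac hzr
  have hz'p : z' ≠ p := by rintro rfl; exact h.not_ac hz'r
  have hpz : ¬ X.Adj p z := fun e => key h.ne_ac h.not_ac hzq e.symm hzr h.ab.symm h.bc
  have hpz' : ¬ X.Adj p z' := fun e => key h.ne_ac h.not_ac hz's e.symm hz'r h.da h.cd.symm
  have hz'q' : z' ≠ q := by rintro rfl; omega
  have hzz'ne : z ≠ z' := by rintro rfl; exact hzs hz's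
  have hzz' : ¬ X.Adj z z' := fun e =>
    key hz'q'.symm (fun e => hz'q e.symm) hzr hzq e h.bc.symm hz'r.symm
  obtain ⟨w, hwp, hwz, hw⟩ := hX.quadrangle a p z q hzp.symm h.ab.symm hzq.symm
    (by omega) (by omega)
  -- replace the base point by `w`
  have far : ∀ v, X.dist a v = X.dist a p + 1 → w ≠ v ∧ ¬ X.Adj w v := fun v hv =>
    ⟨by rintro rfl; omega, fun e => by have := hX.dist_le_succ e a; omega⟩
  have two : ∀ v u, X.dist a v = X.dist a p + 1 → X.Adj w u → X.Adj u v → X.dist w v = 2 := by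
    intro v u hv hwu huv
    have h₁ : 1 < X.dist w v :=
      hX.connected.one_lt_dist_of_ne_of_not_adj (far v hv).1 (far v hv).2
    have h₂ := hX.dist_le_succ huv w
    rw [SimpleGraph.dist_eq_one_iff_adj.2 hwu] at h₂
    omega
  obtain ⟨y, hyr, hys, hy⟩ := hX.triangle w r s h.cd
    ((two r z (by omega) hwz hzr).trans (two s p (by omega) hwp h.da.symm).symm)
  rw [two r z (by omega) hwz hzr] at hy
  have hwy : X.Adj w y := SimpleGraph.dist_eq_one_iff_adj.1 (by omega)
  have hyq : ¬ X.Adj y q := fun e => key h.ne_bd h.not_bd hyr e hys h.bc.symm h.cd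
  have hpy : ¬ X.Adj p y := fun e => key h.ne_ac h.not_ac hys e.symm hyr h.da h.cd.symm
  have hyq' : y ≠ q := by rintro rfl; exact (far _ (by omega)).2 hwy
  have hzy : ¬ X.Adj z y := fun e =>
    key hyq'.symm (fun e => hyq e.symm) hzr hzq e h.bc.symm hyr.symm
  exact h.not_one_near_one hX hwp hwz hzq hzp hwy hyr hyq hpz hpy hzy
    (far q (by omega)).2 (far q (by omega)).1 hyq'

/-- The distance to a fixed vertex is modular on squares. -/
theorem IsSquare.dist_add_dist (hX : IsQuasiMedian X) {p q r s : V} (h : IsSquare X p q r s)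
    (a : V) : X.dist a p + X.dist a r = X.dist a q + X.dist a s := by
  have b₁ := hX.dist_le_succ h.ab a
  have b₂ := hX.dist_le_succ h.ab.symm a
  have b₃ := hX.dist_le_succ h.bc a
  have b₄ := hX.dist_le_succ h.bc.symm a
  have b₅ := hX.dist_le_succ h.cd a
  have b₆ := hX.dist_le_succ h.cd.symm a
  have b₇ := hX.dist_le_succ h.da a
  have b₈ := hX.dist_le_succ h.da.symm a
  have r₁ := h.rotate
  have r₂ := r₁.rotate
  have r₃ := r₂.rotate
  have a₀ := h.not_alternating hX a
  have a₁ := r₁.not_alternating hX a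
  have f₀ := h.not_one_far hX a
  have f₁ := r₁.not_one_far hX a
  have f₂ := r₂.not_one_far hX a
  have f₃ := r₃.not_one_far hX a
  have n₀ := h.not_one_near hX a
  have n₁ := r₁.not_one_near hX a
  have n₂ := r₂.not_one_near hX a
  have n₃ := r₃.not_one_near hX a
  generalize X.dist a p = dp at *
  generalize X.dist a q = dq at *
  generalize X.dist a r = dr at *
  generalize X.dist a s = ds at *
  -- Distances change by at most one along each side. Up to rotation, the non-modular patterns are
  -- exactly the alternating one, one far vertex and one near vertex, all excluded above.
  have c₁ : dq = dp ∨ dq = dp + 1 ∨ dp = dq + 1 := by omega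
  have c₂ : dr = dq ∨ dr = dq + 1 ∨ dq = dr + 1 := by omega
  have c₃ : ds = dr ∨ ds = dr + 1 ∨ dr = ds + 1 := by omega
  clear b₁ b₂ b₃ b₄ b₅ b₆
  rcases c₁ with c₁ | c₁ | c₁ <;> rcases c₂ with c₂ | c₂ | c₂ <;>
    rcases c₃ with c₃ | c₃ | c₃ <;> omega

end Geometry

/-! ### Projections onto cliques, hyperplanes and sectors -/

section Cliques

variable {V : Type*} {X : SimpleGraph V}

/-- A clique with at least two vertices that contains every common neighbour of two of its
vertices. -/
structure IsMaxClique (X : SimpleGraph V) (C : Set V) : Prop where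
  nonempty : C.Nonempty
  adj : ∀ {x y : V}, x ∈ C → y ∈ C → x ≠ y → X.Adj x y
  mem_of_adj : ∀ {x y z : V}, x ∈ C → y ∈ C → x ≠ y → X.Adj z x → X.Adj z y → z ∈ C

/-- The vertices equal or adjacent to each of `x` and `y` are pairwise adjacent, for want of an
induced `K4Minus`. -/
theorem IsQuasiMedian.exists_isMaxClique (hX : IsQuasiMedian X) {x y : V} (h : X.Adj x y) :
    ∃ C, IsMaxClique X C ∧ x ∈ C ∧ y ∈ C := by
  have key : ∀ {u v : V}, X.Adj u x → X.Adj u y → X.Adj v x → X.Adj v y → u ≠ v → X.Adj u v :=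
    fun h₁ h₂ h₃ h₄ => hX.adj_of_common h h₁ h₂ h₃ h₄
  have hx : x ∈ {z | (z = x ∨ X.Adj z x) ∧ (z = y ∨ X.Adj z y)} := ⟨.inl rfl, .inr h⟩
  have hy : y ∈ {z | (z = x ∨ X.Adj z x) ∧ (z = y ∨ X.Adj z y)} := ⟨.inr h.symm, .inl rfl⟩
  have hadj : ∀ {u v : V}, u ∈ {z | (z = x ∨ X.Adj z x) ∧ (z = y ∨ X.Adj z y)} →
      v ∈ {z | (z = x ∨ X.Adj z x) ∧ (z = y ∨ X.Adj z y)} → u ≠ v → X.Adj u v := by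
    rintro u v ⟨h₁, h₂⟩ ⟨h₃, h₄⟩ huv
    by_cases hux : u = x
    · subst hux; exact (h₃.resolve_left huv.symm).symm
    by_cases huy : u = y
    · subst huy; exact (h₄.resolve_left huv.symm).symm
    by_cases hvx : v = x
    · subst hvx; exact h₁.resolve_left huv
    by_cases hvy : v = y
    · subst hvy; exact h₂.resolve_left huv
    exact key (h₁.resolve_left hux) (h₂.resolve_left huy) (h₃.resolve_left hvx)
      (h₄.resolve_left hvy) huv
  refine ⟨_, ⟨⟨x, hx⟩, hadj, fun {u v z} hu hv huv hzu hzv => ?_⟩, hx, hy⟩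
  have aux : ∀ {w}, w ∈ {z | (z = x ∨ X.Adj z x) ∧ (z = y ∨ X.Adj z y)} → z = w ∨ X.Adj z w := by
    intro w hw
    by_cases hwu : w = u
    · exact .inr (hwu ▸ hzu)
    by_cases hwv : w = v
    · exact .inr (hwv ▸ hzv)
    by_cases hzw : z = w
    · exact .inl hzw
    exact .inr (hX.adj_of_common (hadj hu hv huv) hzu hzv (hadj hw hu hwu) (hadj hw hv hwv) hzw)
  exact ⟨aux hx, aux hy⟩

/-- If two vertices of `C` were both closest to `u`, the triangle condition would give a closer
common neighbour, which lies in `C` by maximality. -/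
theorem IsMaxClique.exists_gate (hX : IsQuasiMedian X) {C : Set V} (hC : IsMaxClique X C) (u : V) :
    ∃ p ∈ C, ∀ q ∈ C, q ≠ p → X.dist q u = X.dist p u + 1 := by
  obtain ⟨p, hp, hmin⟩ := exists_minimalFor_of_wellFoundedLT (· ∈ C) (fun q => X.dist u q)
    hC.nonempty
  have hmin' : ∀ q ∈ C, X.dist u p ≤ X.dist u q := fun q hq => by
    by_contra hlt
    exact hlt (hmin hq (by simpa using (not_le.1 hlt).le))
  refine ⟨p, hp, fun q hq hqp => ?_⟩
  rw [SimpleGraph.dist_comm, X.dist_comm (u := p)]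
  have h₁ := hmin' q hq
  have h₂ := hX.dist_le_succ (hC.adj hp hq hqp.symm) u
  by_contra hne
  obtain ⟨z, hzp, hzq, hz⟩ := hX.triangle u p q (hC.adj hp hq hqp.symm) (by omega)
  have h₃ := hmin' z (hC.mem_of_adj hp hq hqp.symm hzp hzq)
  omega

open Classical in
/-- The vertex of the clique `C` closest to `u`. -/
noncomputable def proj (X : SimpleGraph V) (C : Set V) (u : V) : V :=
  if h : ∃ p ∈ C, ∀ q ∈ C, q ≠ p → X.dist q u = X.dist p u + 1 then h.choose else u

section Proj

variable {C : Set V}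

theorem IsMaxClique.proj_mem (hX : IsQuasiMedian X) (hC : IsMaxClique X C) (u : V) :
    proj X C u ∈ C := by
  rw [proj, dif_pos (hC.exists_gate hX u)]
  exact (hC.exists_gate hX u).choose_spec.1

theorem IsMaxClique.dist_of_ne_proj (hX : IsQuasiMedian X) (hC : IsMaxClique X C) {u q : V}
    (hq : q ∈ C) (h : q ≠ proj X C u) : X.dist q u = X.dist (proj X C u) u + 1 := by
  rw [proj, dif_pos (hC.exists_gate hX u)] at h ⊢
  exact (hC.exists_gate hX u).choose_spec.2 q hq h

theorem IsMaxClique.proj_eq (hX : IsQuasiMedian X) (hC : IsMaxClique X C) {u p : V}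
    (hp : p ∈ C) (h : ∀ q ∈ C, q ≠ p → X.dist p u < X.dist q u) : proj X C u = p := by
  by_contra hne
  have h₁ := h _ (hC.proj_mem hX u) hne
  have h₂ := hC.dist_of_ne_proj hX hp (Ne.symm hne)
  omega

theorem IsMaxClique.proj_self (hX : IsQuasiMedian X) (hC : IsMaxClique X C) {u : V}
    (hu : u ∈ C) : proj X C u = u :=
  hC.proj_eq hX hu fun q _ hqu => by
    rw [SimpleGraph.dist_self]
    exact hX.connected.pos_dist_of_ne hqu

theorem IsMaxClique.dist_proj_eq (hX : IsQuasiMedian X) (hC : IsMaxClique X C) {u v : V}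
    (huv : X.Adj u v) (h : proj X C u ≠ proj X C v) :
    X.dist (proj X C u) u = X.dist (proj X C v) v := by
  have h₁ := hC.dist_of_ne_proj hX (hC.proj_mem hX u) h
  have h₂ := hC.dist_of_ne_proj hX (hC.proj_mem hX v) h.symm
  have h₃ := hX.dist_le_succ huv (proj X C u)
  have h₄ := hX.dist_le_succ huv.symm (proj X C v)
  omega

/-- If `v` and `w` had the same projection, they would be equidistant from it. A common neighbour
`z` one step closer is adjacent to `u` by the absence of `K4Minus`, yet `u` is two steps further
than `z`. -/
theorem IsMaxClique.proj_ne_of_triangle (hX : IsQuasiMedian X) (hC : IsMaxClique X C) {u v w : V}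
    (huv : X.Adj u v) (hvw : X.Adj v w) (huw : X.Adj u w) (h : proj X C u ≠ proj X C v) :
    proj X C v ≠ proj X C w := by
  intro hvw'
  have e₁ := hC.dist_proj_eq hX huv h
  have e₂ := hC.dist_proj_eq hX huw (hvw' ▸ h)
  have e₃ := hC.dist_of_ne_proj hX (hC.proj_mem hX v) h.symm
  rw [← hvw'] at e₂
  obtain ⟨z, hzv, hzw, hz⟩ := hX.triangle (proj X C v) v w hvw (by omega)
  have hzu : z ≠ u := by rintro rfl; omega
  have hadj := hX.adj_of_common hvw hzv hzw huv huw hzu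
  have := hX.dist_le_succ hadj (proj X C v)
  omega

/-- Let `f` be the distance to `proj X C u` minus the distance to `proj X C v`. It increases by 2
from `u` to `v`, hence from `z` to `w` by modularity. But `f` depends only on the projection of its
argument to `C`. -/
theorem IsMaxClique.proj_ne_of_square (hX : IsQuasiMedian X) (hC : IsMaxClique X C) {u v w z : V}
    (hs : IsSquare X u v w z) (h : proj X C u ≠ proj X C v) : proj X C z ≠ proj X C w := by
  intro hzw
  have e := hC.dist_proj_eq hX hs.ab h
  have e₁ := hC.dist_of_ne_proj hX (hC.proj_mem hX v) h.symm
  have e₂ := hC.dist_of_ne_proj hX (hC.proj_mem hX u) h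
  have m₁ := hs.dist_add_dist hX (proj X C u)
  have m₂ := hs.dist_add_dist hX (proj X C v)
  have gz := fun q hq hqz => hC.dist_of_ne_proj hX (u := z) (q := q) hq hqz
  have gw := fun q hq hqw => hC.dist_of_ne_proj hX (u := w) (q := q) hq hqw
  have hu := hC.proj_mem hX u
  have hv := hC.proj_mem hX v
  rw [hzw] at gz
  by_cases h₁ : proj X C u = proj X C w
  · have h₂ : proj X C v ≠ proj X C w := h₁ ▸ h.symm
    have := gz _ hv h₂
    have := gw _ hv h₂
    have hz := congrArg (X.dist · z) h₁
    have hw := congrArg (X.dist · w) h₁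
    omega
  · have a₁ := gz _ hu h₁
    have a₂ := gw _ hu h₁
    by_cases h₂ : proj X C v = proj X C w
    · have hz := congrArg (X.dist · z) h₂
      have hw := congrArg (X.dist · w) h₂
      omega
    · have := gz _ hv h₂
      have := gw _ hv h₂
      omega

end Proj

theorem mk_eq_of_parallel {e f : X.edgeSet} (h : Parallel X e f) :
    Hyperplane.mk e = Hyperplane.mk f :=
  Quotient.sound (Relation.EqvGen.rel _ _ h)

theorem mem_edges_mk {x y : V} (h : X.Adj x y) :
    s(x, y) ∈ (Hyperplane.mk (⟨s(x, y), h⟩ : X.edgeSet)).edges := ⟨h, rfl⟩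

theorem adj_of_mem_edges {J : Hyperplane X} {x y : V} (h : s(x, y) ∈ J.edges) : X.Adj x y := h.1

theorem eq_of_mem_edges {J J' : Hyperplane X} {e : Sym2 V} (h : e ∈ J.edges) (h' : e ∈ J'.edges) :
    J = J' := h.2.symm.trans h'.2

theorem mem_edges_swap {J : Hyperplane X} {x y : V} (h : s(x, y) ∈ J.edges) :
    s(y, x) ∈ J.edges := by rwa [Sym2.eq_swap]

theorem mem_edges_of_triangle {J : Hyperplane X} {a b c : V} (hJ : s(a, b) ∈ J.edges)
    (hbc : X.Adj b c) (hac : X.Adj a c) : s(b, c) ∈ J.edges :=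
  ⟨hbc, (mk_eq_of_parallel (e := ⟨s(a, b), hJ.1⟩)
    (.inl ⟨a, b, c, hJ.1, hbc, hac, rfl, rfl⟩)).symm.trans hJ.2⟩

theorem IsSquare.mem_edges {J : Hyperplane X} {a b c d : V} (h : IsSquare X a b c d)
    (hJ : s(a, b) ∈ J.edges) : s(d, c) ∈ J.edges :=
  ⟨h.cd.symm, (mk_eq_of_parallel (e := ⟨s(a, b), hJ.1⟩)
    (.inr ⟨a, b, c, d, h, rfl, rfl⟩)).symm.trans hJ.2⟩

theorem IsMaxClique.mem_edges {C : Set V} (hC : IsMaxClique X C) {J : Hyperplane X} {x y u v : V}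
    (hx : x ∈ C) (hy : y ∈ C) (hJ : s(x, y) ∈ J.edges) (hu : u ∈ C) (hv : v ∈ C) (huv : u ≠ v) :
    s(u, v) ∈ J.edges := by
  have step : ∀ {x y v : V}, x ∈ C → y ∈ C → s(x, y) ∈ J.edges → v ∈ C → y ≠ v →
      s(y, v) ∈ J.edges := by
    intro x y v hx hy hJ hv hyv
    by_cases hxv : x = v
    · exact hxv ▸ mem_edges_swap hJ
    · exact mem_edges_of_triangle hJ (hC.adj hy hv hyv) (hC.adj hx hv hxv)
  by_cases hyu : y = u
  · subst hyu; exact step hx hy hJ hv huv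
  · exact step hy hu (step hx hy hJ hu hyu) hv huv

theorem IsMaxClique.proj_ne_of_parallel (hX : IsQuasiMedian X) {C : Set V} (hC : IsMaxClique X C)
    {e f : X.edgeSet} (h : Parallel X e f) :
    (∀ u v, e.1 = s(u, v) → proj X C u ≠ proj X C v) ↔
      (∀ u v, f.1 = s(u, v) → proj X C u ≠ proj X C v) := by
  have sym : ∀ a b : V, (∀ u v, s(a, b) = s(u, v) → proj X C u ≠ proj X C v) ↔
      proj X C a ≠ proj X C b := by
    refine fun a b => ⟨fun h => h a b rfl, fun h u v huv => ?_⟩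
    rcases Sym2.eq_iff.1 huv with ⟨rfl, rfl⟩ | ⟨rfl, rfl⟩
    exacts [h, h.symm]
  rcases h with ⟨a, b, c, hab, hbc, hac, he, hf⟩ | ⟨a, b, c, d, hs, he, hf⟩
  · rw [he, hf, sym, sym]
    exact ⟨hC.proj_ne_of_triangle hX hab hbc hac, fun h =>
      (hC.proj_ne_of_triangle hX hbc.symm hab.symm hac.symm h.symm).symm⟩
  · rw [he, hf, sym, sym]
    exact ⟨hC.proj_ne_of_square hX hs, fun h =>
      (hC.proj_ne_of_square hX hs.rotate.rotate h.symm).symm⟩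

/-- By induction on the distance to `C`: the quadrangle condition builds a square in which the edge
from `u` to `v` is opposite to an edge one step closer to `C`, whose ends still have distinct
projections. -/
theorem IsMaxClique.mem_edges_of_proj_ne (hX : IsQuasiMedian X) {C : Set V}
    (hC : IsMaxClique X C) {J : Hyperplane X} {x y : V} (hx : x ∈ C) (hy : y ∈ C)
    (hJ : s(x, y) ∈ J.edges) (n : ℕ) {u v : V} (huv : X.Adj u v)
    (h : proj X C u ≠ proj X C v) (hn : X.dist (proj X C u) u = n) : s(u, v) ∈ J.edges := by
  induction n generalizing u v with
  | zero =>
    have e := hC.dist_proj_eq hX huv h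
    have h₁ := (hX.connected.dist_eq_zero_iff).1 hn
    have h₂ := (hX.connected.dist_eq_zero_iff).1 (e.symm.trans hn)
    have hu := hC.proj_mem hX u
    have hv := hC.proj_mem hX v
    rw [h₁] at hu
    rw [h₂] at hv
    exact hC.mem_edges hx hy hJ hu hv huv.ne
  | succ n ih =>
    have e := hC.dist_proj_eq hX huv h
    have e₁ := hC.dist_of_ne_proj hX (hC.proj_mem hX u) h
    have e₂ := hC.dist_of_ne_proj hX (hC.proj_mem hX v) h.symm
    have hne : proj X C u ≠ u := by
      intro h'
      rw [h', SimpleGraph.dist_self] at hn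
      omega
    obtain ⟨u', hu', hd⟩ := hX.exists_adj_dist hne
    have hC_le : ∀ q ∈ C, q ≠ proj X C u → X.dist (proj X C u) u' < X.dist q u' := by
      intro q hq hqu
      have h₁ := hC.dist_of_ne_proj hX hq hqu
      have h₂ := hX.dist_le_succ hu' q
      omega
    have hpu' : proj X C u' = proj X C u := hC.proj_eq hX (hC.proj_mem hX u) hC_le
    have d₁ := hC_le _ (hC.proj_mem hX v) h.symm
    have d₂ := hX.dist_le_succ (hC.adj (hC.proj_mem hX u) (hC.proj_mem hX v) h) u'
    rw [X.dist_comm (v := proj X C v), X.dist_comm (v := proj X C u)] at d₂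
    have hvu' : v ≠ u' := by rintro rfl; exact h hpu'.symm
    have nadj : ¬ X.Adj v u' := by
      intro h'
      have := hX.dist_le_succ h'.symm (proj X C u)
      omega
    obtain ⟨w, hwv, hwu', hw⟩ := hX.quadrangle (proj X C v) v u' u hvu' huv hu'.symm
      (by omega) (by omega)
    have hwu : w ≠ u := by rintro rfl; omega
    have nwu : ¬ X.Adj u w := by
      intro h'
      have := hX.dist_le_succ h'.symm (proj X C v)
      omega
    have hs : IsSquare X u' w v u := ⟨hwu'.symm, hwv, huv.symm, hu'.symm, hvu'.symm, hwu,
      fun h' => nadj h'.symm, fun h' => nwu h'.symm⟩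
    refine hs.mem_edges (ih hwu'.symm (fun h' => ?_) (by rw [hpu']; omega))
    exact hC.proj_ne_of_square hX hs.rotate.rotate (u := v) (v := u) h.symm h'.symm

/-- Having ends with distinct projections is invariant under `Parallel`, hence constant on the
generated classes. -/
theorem IsMaxClique.mem_edges_iff (hX : IsQuasiMedian X) {C : Set V}
    (hC : IsMaxClique X C) {J : Hyperplane X} {x y : V} (hx : x ∈ C) (hy : y ∈ C)
    (hJ : s(x, y) ∈ J.edges) {u v : V} :
    s(u, v) ∈ J.edges ↔ X.Adj u v ∧ proj X C u ≠ proj X C v := by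
  refine ⟨fun h => ⟨h.1, ?_⟩, fun h => hC.mem_edges_of_proj_ne hX hx hy hJ _ h.1 h.2 rfl⟩
  have key : ∀ {e f : X.edgeSet}, Relation.EqvGen (Parallel X) e f →
      ((∀ u v, e.1 = s(u, v) → proj X C u ≠ proj X C v) ↔
        (∀ u v, f.1 = s(u, v) → proj X C u ≠ proj X C v)) := by
    intro e f h
    induction h with
    | rel _ _ h => exact hC.proj_ne_of_parallel hX h
    | refl _ => exact Iff.rfl
    | symm _ _ _ ih => exact ih.symm
    | trans _ _ _ _ _ ih₁ ih₂ => exact ih₁.trans ih₂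
  have hr : Relation.EqvGen (Parallel X) ⟨s(x, y), hJ.1⟩ ⟨s(u, v), h.1⟩ :=
    Quotient.exact (hJ.2.trans h.2.symm)
  refine (key hr).1 (fun a b hab => ?_) u v rfl
  have hne : x ≠ y := (adj_of_mem_edges hJ).ne
  rcases Sym2.eq_iff.1 hab with ⟨rfl, rfl⟩ | ⟨rfl, rfl⟩
  · rwa [hC.proj_self hX hx, hC.proj_self hX hy]
  · rw [hC.proj_self hX hx, hC.proj_self hX hy]
    exact hne.symm

end Cliques

/-! ### The local structure of hyperplanes -/

section Local

variable {V : Type*} {X : SimpleGraph V}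

/-- The sector of `J` containing the vertex `u`. -/
def sectorOf (J : Hyperplane X) (u : V) : J.Sector :=
  (X.deleteEdges J.edges).connectedComponentMk u

theorem sectorOf_surjective (J : Hyperplane X) (S : J.Sector) : ∃ u, sectorOf J u = S := by
  induction S using SimpleGraph.ConnectedComponent.ind with
  | _ v => exact ⟨v, rfl⟩

theorem sectorOf_eq_of_adj {J : Hyperplane X} {u v : V} (h : X.Adj u v)
    (hJ : s(u, v) ∉ J.edges) : sectorOf J u = sectorOf J v :=
  SimpleGraph.ConnectedComponent.eq.2
    (SimpleGraph.Adj.reachable ((SimpleGraph.deleteEdges_adj).2 ⟨h, hJ⟩))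

/-- A geodesic from `u` to its projection has constant projection, so it avoids `J`; conversely the
projection only changes across edges of `J`. -/
theorem IsMaxClique.sectorOf_eq_iff (hX : IsQuasiMedian X) {C : Set V}
    (hC : IsMaxClique X C) {J : Hyperplane X} {x y : V} (hx : x ∈ C) (hy : y ∈ C)
    (hJ : s(x, y) ∈ J.edges) {u v : V} :
    sectorOf J u = sectorOf J v ↔ proj X C u = proj X C v := by
  have key : ∀ n u, X.dist (proj X C u) u = n → sectorOf J u = sectorOf J (proj X C u) := by
    intro n
    induction n with
    | zero =>
      intro u hu
      rw [(hX.connected.dist_eq_zero_iff).1 hu]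
    | succ n ih =>
      intro u hn
      have hne : proj X C u ≠ u := by
        intro h'
        rw [h', SimpleGraph.dist_self] at hn
        omega
      obtain ⟨w, hw, hd⟩ := hX.exists_adj_dist hne
      have hpw : proj X C w = proj X C u := by
        refine hC.proj_eq hX (hC.proj_mem hX u) fun q hq hqu => ?_
        have h₁ := hC.dist_of_ne_proj hX hq hqu
        have h₂ := hX.dist_le_succ hw q
        omega
      have e := ih w (by rw [hpw]; omega)
      rw [hpw] at e
      rw [← e]
      exact sectorOf_eq_of_adj hw.symm fun h' =>
        ((hC.mem_edges_iff hX hx hy hJ).1 h').2 hpw.symm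
  refine ⟨fun h => ?_, fun h => ?_⟩
  · obtain ⟨p⟩ := SimpleGraph.ConnectedComponent.eq.1 h
    clear h
    induction p with
    | nil => rfl
    | cons hadj _ ih =>
      rw [SimpleGraph.deleteEdges_adj] at hadj
      refine Eq.trans ?_ ih
      by_contra hne
      exact hadj.2 ((hC.mem_edges_iff hX hx hy hJ).2 ⟨hadj.1, hne⟩)
  · rw [key _ u rfl, key _ v rfl, h]

theorem mem_carrier_iff {J : Hyperplane X} {y : V} :
    y ∈ J.carrier ↔ ∃ z, s(y, z) ∈ J.edges := by
  refine ⟨?_, fun ⟨z, hz⟩ => ⟨_, hz, Sym2.mem_mk_left y z⟩⟩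
  rintro ⟨e, he, hy⟩
  obtain ⟨z, rfl⟩ := Sym2.mem_iff_exists.1 hy
  exact ⟨z, he⟩

theorem sectorOf_ne (hX : IsQuasiMedian X) {J : Hyperplane X} {u v : V}
    (h : s(u, v) ∈ J.edges) : sectorOf J u ≠ sectorOf J v := by
  obtain ⟨C, hC, hu, hv⟩ := hX.exists_isMaxClique (adj_of_mem_edges h)
  rw [Ne, hC.sectorOf_eq_iff hX hu hv h, hC.proj_self hX hu, hC.proj_self hX hv]
  exact (adj_of_mem_edges h).ne

theorem adj_of_mem_edges_of_mem_edges (hX : IsQuasiMedian X) {J : Hyperplane X} {y u v : V}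
    (hu : s(y, u) ∈ J.edges) (hv : s(y, v) ∈ J.edges) (huv : u ≠ v) : X.Adj u v := by
  obtain ⟨C, hC, hyC, huC⟩ := hX.exists_isMaxClique (adj_of_mem_edges hu)
  have h := ((hC.mem_edges_iff hX hyC huC hu).1 hv).2
  have e := hC.dist_proj_eq hX (adj_of_mem_edges hv) h
  rw [hC.proj_self hX hyC, SimpleGraph.dist_self] at e
  have e' := (hX.connected.dist_eq_zero_iff).1 e.symm
  exact hC.adj huC (e' ▸ hC.proj_mem hX v) huv

theorem mem_edges_of_common_vertex (hX : IsQuasiMedian X) {J : Hyperplane X} {y u v : V}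
    (hu : s(y, u) ∈ J.edges) (hv : s(y, v) ∈ J.edges) (huv : u ≠ v) : s(u, v) ∈ J.edges :=
  mem_edges_of_triangle hu (adj_of_mem_edges_of_mem_edges hX hu hv huv) (adj_of_mem_edges hv)

theorem eq_of_sectorOf_eq (hX : IsQuasiMedian X) {J : Hyperplane X} {y u v : V}
    (hu : s(y, u) ∈ J.edges) (hv : s(y, v) ∈ J.edges) (h : sectorOf J u = sectorOf J v) :
    u = v := by
  by_contra huv
  exact sectorOf_ne hX (mem_edges_of_common_vertex hX hu hv huv) h

/-- A maximal clique of `J` through `y` meets every sector: `proj X C v` is its vertex in the sector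
of `v`. -/
theorem exists_mem_edges_sectorOf (hX : IsQuasiMedian X) {J : Hyperplane X} {y v : V}
    (hy : y ∈ J.carrier) (h : sectorOf J y ≠ sectorOf J v) :
    ∃ z, s(y, z) ∈ J.edges ∧ sectorOf J z = sectorOf J v := by
  obtain ⟨u, hu⟩ := mem_carrier_iff.1 hy
  obtain ⟨C, hC, hyC, huC⟩ := hX.exists_isMaxClique (adj_of_mem_edges hu)
  have key : sectorOf J (proj X C v) = sectorOf J v :=
    (hC.sectorOf_eq_iff hX hyC huC hu).2 (hC.proj_self hX (hC.proj_mem hX v))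
  refine ⟨proj X C v, hC.mem_edges hyC huC hu hyC (hC.proj_mem hX v) ?_, key⟩
  intro e
  rw [← e] at key
  exact h key

/-- The vertex `u` is at distance 2 from both ends of the side `w t`, so the triangle condition
supplies the fourth vertex of the new square. -/
theorem IsSquare.exists_replace (hX : IsQuasiMedian X) {J₁ J₂ : Hyperplane X} (hJ : J₁ ≠ J₂)
    {y s w t u : V}
    (h : IsSquare X y s w t) (hs : s(y, s) ∈ J₁.edges) (ht : s(y, t) ∈ J₂.edges)
    (hu : s(y, u) ∈ J₁.edges) : ∃ z, IsSquare X y u z t := by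
  by_cases hus : u = s
  · exact ⟨w, hus ▸ h⟩
  have adj_us := adj_of_mem_edges_of_mem_edges hX hu hs hus
  have nadj_ut : ∀ {v}, s(y, v) ∈ J₁.edges → ¬ X.Adj v t := fun {v} hv h' => by
    have h₁ := mem_edges_of_triangle (mem_edges_swap hv) (adj_of_mem_edges ht) h'
    exact hJ (eq_of_mem_edges h₁ ht)
  have hut : u ≠ t := fun e => hJ (eq_of_mem_edges hu (e ▸ ht))
  have nadj_uw : ¬ X.Adj u w := fun h' =>
    h.not_ac (hX.adj_of_common adj_us (adj_of_mem_edges hu) h.ab h'.symm h.bc.symm h.ne_ac)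
  have huw : u ≠ w := by rintro rfl; exact h.not_ac (adj_of_mem_edges hu)
  have d₁ : X.dist u w = 2 := by
    have h₁ := hX.connected.one_lt_dist_of_ne_of_not_adj huw nadj_uw
    have h₂ := hX.dist_le_succ h.bc u
    rw [SimpleGraph.dist_eq_one_iff_adj.2 adj_us] at h₂
    omega
  have d₂ : X.dist u t = 2 := by
    have h₁ := hX.connected.one_lt_dist_of_ne_of_not_adj hut (nadj_ut hu)
    have h₂ := hX.dist_le_succ (adj_of_mem_edges ht) u
    rw [SimpleGraph.dist_eq_one_iff_adj.2 (adj_of_mem_edges hu).symm] at h₂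
    omega
  obtain ⟨z, hzw, hzt, hz⟩ := hX.triangle u w t h.cd (d₁.trans d₂.symm)
  have huz : X.Adj u z := SimpleGraph.dist_eq_one_iff_adj.1 (by omega)
  have hyz : y ≠ z := by rintro rfl; exact h.not_ac hzw
  refine ⟨z, adj_of_mem_edges hu, huz, hzt, h.da, hyz, hut, fun h' => ?_, nadj_ut hu⟩
  exact h.not_ac (hX.adj_of_common hzt h' h.da.symm hzw.symm h.cd h.ne_ac)

/-- If `J₁ ≠ J₂` are transverse, then any two edges in `J₁` and `J₂` with a common endpoint span
a square. -/
theorem Hyperplane.Transverse.exists_square (hX : IsQuasiMedian X) {J₁ J₂ : Hyperplane X}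
    (hT : J₁.Transverse J₂) (hJ : J₁ ≠ J₂) {y u v : V} (hu : s(y, u) ∈ J₁.edges)
    (hv : s(y, v) ∈ J₂.edges) : ∃ z, IsSquare X y u z v := by
  obtain ⟨C₁, hC₁, hy₁, hu₁⟩ := hX.exists_isMaxClique (adj_of_mem_edges hu)
  obtain ⟨C₂, hC₂, hy₂, hv₂⟩ := hX.exists_isMaxClique (adj_of_mem_edges hv)
  obtain ⟨a, b, c, d, hs, hab, had⟩ := hT
  have hdc := hs.mem_edges hab
  have hbc := hs.reflect.mem_edges had
  have p₁ : proj X C₁ a ≠ proj X C₁ b := ((hC₁.mem_edges_iff hX hy₁ hu₁ hu).1 hab).2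
  have p₂ : proj X C₁ d ≠ proj X C₁ c := ((hC₁.mem_edges_iff hX hy₁ hu₁ hu).1 hdc).2
  have q₁ : proj X C₂ a ≠ proj X C₂ d := ((hC₂.mem_edges_iff hX hy₂ hv₂ hv).1 had).2
  have q₂ : proj X C₂ b ≠ proj X C₂ c := ((hC₂.mem_edges_iff hX hy₂ hv₂ hv).1 hbc).2
  have p₃ : proj X C₁ a = proj X C₁ d := (hC₁.sectorOf_eq_iff hX hy₁ hu₁ hu).1
    (sectorOf_eq_of_adj hs.da.symm fun h' => hJ (eq_of_mem_edges h' had))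
  have p₄ : proj X C₁ b = proj X C₁ c := (hC₁.sectorOf_eq_iff hX hy₁ hu₁ hu).1
    (sectorOf_eq_of_adj hs.bc fun h' => hJ (eq_of_mem_edges h' hbc))
  have q₃ : proj X C₂ a = proj X C₂ b := (hC₂.sectorOf_eq_iff hX hy₂ hv₂ hv).1
    (sectorOf_eq_of_adj hs.ab fun h' => hJ (eq_of_mem_edges hab h'))
  have q₄ : proj X C₂ d = proj X C₂ c := (hC₂.sectorOf_eq_iff hX hy₂ hv₂ hv).1
    (sectorOf_eq_of_adj hs.cd.symm fun h' => hJ (eq_of_mem_edges hdc h'))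
  -- Crossing either hyperplane changes one projection and keeps the other, so some corner of the
  -- given square is separated from `y` by both. The quadrangle condition based there produces a
  -- square at `y`.
  obtain ⟨w, hw₁, hw₂⟩ : ∃ w, proj X C₁ w ≠ y ∧ proj X C₂ w ≠ y := by
    by_cases h₁ : proj X C₁ a = y
    · by_cases h₂ : proj X C₂ a = y
      · exact ⟨c, by rw [← p₄, ← h₁]; exact p₁.symm, by rw [← q₄, ← h₂]; exact q₁.symm⟩
      · exact ⟨b, by rw [← h₁]; exact p₁.symm, by rwa [← q₃]⟩
    · by_cases h₂ : proj X C₂ a = y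
      · exact ⟨d, by rwa [← p₃], by rw [← h₂]; exact q₁.symm⟩
      · exact ⟨a, h₁, h₂⟩
  have hs₁ := hC₁.mem_edges hy₁ hu₁ hu hy₁ (hC₁.proj_mem hX w) hw₁.symm
  have hs₂ := hC₂.mem_edges hy₂ hv₂ hv hy₂ (hC₂.proj_mem hX w) hw₂.symm
  have d₁ := hC₁.dist_of_ne_proj hX hy₁ hw₁.symm
  have d₂ := hC₂.dist_of_ne_proj hX hy₂ hw₂.symm
  have hne : proj X C₁ w ≠ proj X C₂ w := fun e => hJ (eq_of_mem_edges hs₁ (e ▸ hs₂))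
  obtain ⟨z, hz₁, hz₂, hz⟩ := hX.quadrangle w (proj X C₁ w) (proj X C₂ w) y hne
    (adj_of_mem_edges hs₁) (adj_of_mem_edges hs₂)
    (by rw [X.dist_comm, X.dist_comm (u := w)]; omega)
    (by rw [X.dist_comm, X.dist_comm (u := w)]; omega)
  have hyz : y ≠ z := by rintro rfl; omega
  have nyz : ¬ X.Adj y z := by
    intro h'
    have := hX.dist_le_succ h'.symm w
    omega
  have sq : IsSquare X y (proj X C₁ w) z (proj X C₂ w) :=
    ⟨adj_of_mem_edges hs₁, hz₁.symm, hz₂, (adj_of_mem_edges hs₂).symm, hyz, hne, nyz, fun h' =>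
      hJ (eq_of_mem_edges (mem_edges_of_triangle (mem_edges_swap hs₁) (adj_of_mem_edges hs₂) h')
        hs₂)⟩
  obtain ⟨z', sq'⟩ := sq.exists_replace hX hJ hs₁ hs₂ hu
  obtain ⟨z'', sq''⟩ := sq'.reflect.exists_replace hX hJ.symm hs₂ hu hv
  exact ⟨z'', sq''.reflect⟩

end Local

/-! ### Convexity of gated subgraphs -/

section Gated

variable {V : Type*} {X : SimpleGraph V} {Y : Set V}

theorem IsGate.dist_eq (hX : IsQuasiMedian X) {x y z : V} (h : IsGate X Y x y) (hz : z ∈ Y) :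
    X.dist x z = X.dist x y + X.dist y z := by
  classical
  obtain ⟨p, hp, hy⟩ := h.2 z hz
  have h₁ := SimpleGraph.dist_le (p.takeUntil y hy)
  have h₂ := SimpleGraph.dist_le (p.dropUntil y hy)
  have h₃ := hX.connected.dist_triangle (u := x) (v := y) (w := z)
  have h₄ := congrArg SimpleGraph.Walk.length (p.take_spec hy)
  rw [SimpleGraph.Walk.length_append] at h₄
  omega

theorem IsGated.nonempty (hX : IsQuasiMedian X) (hY : IsGated X Y) : Y.Nonempty := by
  obtain ⟨x⟩ := hX.connected.nonempty
  obtain ⟨y, hy⟩ := hY x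
  exact ⟨y, hy.1⟩

theorem IsGated.mem_of_dist (hX : IsQuasiMedian X) (hY : IsGated X Y) {x y w : V} (hx : x ∈ Y)
    (hy : y ∈ Y) (h : X.dist x y = X.dist w x + X.dist w y) : w ∈ Y := by
  obtain ⟨p, hp⟩ := hY w
  have h₁ := hp.dist_eq hX hx
  have h₂ := hp.dist_eq hX hy
  have h₃ := hX.connected.dist_triangle (u := x) (v := p) (w := y)
  rw [X.dist_comm (u := x) (v := p)] at h₃
  have h₄ : w = p := (hX.connected.dist_eq_zero_iff).1 (by omega)
  exact h₄ ▸ hp.1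

theorem IsGated.mem_of_adj (hX : IsQuasiMedian X) (hY : IsGated X Y) {x y w : V} (hx : x ∈ Y)
    (hy : y ∈ Y) (hxy : x ≠ y) (hwx : X.Adj w x) (hwy : X.Adj w y) : w ∈ Y := by
  obtain ⟨p, hp⟩ := hY w
  have h₁ := hp.dist_eq hX hx
  have h₂ := hp.dist_eq hX hy
  rw [SimpleGraph.dist_eq_one_iff_adj.2 hwx] at h₁
  rw [SimpleGraph.dist_eq_one_iff_adj.2 hwy] at h₂
  by_cases h : w = p
  · exact h ▸ hp.1
  have h₃ := hX.connected.pos_dist_of_ne h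
  have h₄ : p = x := (hX.connected.dist_eq_zero_iff).1 (by omega)
  have h₅ : p = y := (hX.connected.dist_eq_zero_iff).1 (by omega)
  exact absurd (h₄.symm.trans h₅) hxy

end Gated

/-! ### Potentials and virtual retracts -/

section Potential

variable {V : Type*} {X : SimpleGraph V}

/-- The product of the labels `π` along a walk, read from its end to its start. -/
def holonomy {P : Type*} [Group P] (π : V → V → P) : {u v : V} → X.Walk u v → P
  | _, _, .nil => 1
  | u, _, .cons (v := w) _ p => π w u * holonomy π p

theorem IsQuasiMedian.adj_induction (hX : IsQuasiMedian X) {p : V → Prop} (x₀ : V) (h₀ : p x₀)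
    (h : ∀ a b, X.Adj a b → p a → p b) (v : V) : p v := by
  obtain ⟨w⟩ := hX.connected.preconnected x₀ v
  induction w with
  | nil => exact h₀
  | cons hadj _ ih => exact ih (h _ _ hadj h₀)

variable {P : Type*} [Group P]

/-- Two geodesics from `v` to `x₀` starting towards `a` and `b` are both compared with geodesics
through a vertex `z` two steps closer to `x₀`. It comes from the triangle condition if `a`, `b` are
adjacent (two triangles), and from the quadrangle condition otherwise (one square). -/
theorem IsQuasiMedian.holonomy_eq (hX : IsQuasiMedian X) (π : V → V → P)
    (tri : ∀ a b c, X.Adj a b → X.Adj b c → X.Adj a c → π b c * π a b = π a c)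
    (sq : ∀ a b c d, IsSquare X a b c d → π b c * π a b = π d c * π a d) (x₀ : V) (n : ℕ)
    {v : V} (hv : X.dist x₀ v = n) (p q : X.Walk v x₀) (hp : p.length = n) (hq : q.length = n) :
    holonomy π p = holonomy π q := by
  induction n using Nat.strong_induction_on generalizing v with
  | _ n ih =>
    cases p with
    | nil =>
      cases q with
      | nil => rfl
      | cons _ _ => simp at hp hq; omega
    | @cons _ a _ ha p =>
      cases q with
      | nil => simp at hp hq; omega
      | @cons _ b _ hb q =>
        rw [SimpleGraph.Walk.length_cons] at hp hq
        have da : X.dist x₀ a + 1 = n := by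
          have h₁ := SimpleGraph.dist_le p
          have h₂ := hX.dist_le_succ ha.symm x₀
          rw [X.dist_comm] at h₁
          omega
        have db : X.dist x₀ b + 1 = n := by
          have h₁ := SimpleGraph.dist_le q
          have h₂ := hX.dist_le_succ hb.symm x₀
          rw [X.dist_comm] at h₁
          omega
        change π a v * holonomy π p = π b v * holonomy π q
        by_cases hab : a = b
        · subst hab
          rw [ih (X.dist x₀ a) (by omega) rfl p q (by omega) (by omega)]
        have key : ∀ z, X.Adj z a → X.Adj z b → X.dist x₀ z + 2 = n →
            π a v * π z a = π b v * π z b → π a v * holonomy π p = π b v * holonomy π q := by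
          intro z hza hzb hz e
          obtain ⟨r, hr⟩ := hX.connected.exists_walk_length_eq_dist z x₀
          rw [X.dist_comm] at hr
          rw [ih (X.dist x₀ a) (by omega) rfl p (.cons hza.symm r) (by omega)
              (by rw [SimpleGraph.Walk.length_cons]; omega),
            ih (X.dist x₀ b) (by omega) rfl q (.cons hzb.symm r) (by omega)
              (by rw [SimpleGraph.Walk.length_cons]; omega)]
          change π a v * (π z a * holonomy π r) = π b v * (π z b * holonomy π r)
          rw [← mul_assoc, e, mul_assoc]
        by_cases hadj : X.Adj a b
        · obtain ⟨z, hza, hzb, hz⟩ := hX.triangle x₀ a b hadj (by omega)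
          refine key z hza hzb (by omega) ?_
          rw [← tri z a b hza hadj hzb, ← tri a b v hadj hb.symm ha.symm, mul_assoc]
        · obtain ⟨z, hza, hzb, hz⟩ := hX.quadrangle x₀ a b v hab ha hb (by omega) (by omega)
          refine key z hza hzb (by omega) (sq z a v b ⟨hza, ha.symm, hb, hzb.symm, ?_, hab, ?_,
            hadj⟩)
          · rintro rfl; omega
          · intro h'
            have := hX.dist_le_succ h' x₀
            omega

/-- Quasi-median graphs become simply connected when triangles and squares are filled in. -/
theorem IsQuasiMedian.exists_potential (hX : IsQuasiMedian X) (π : V → V → P)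
    (inv : ∀ a b, X.Adj a b → π b a * π a b = 1)
    (tri : ∀ a b c, X.Adj a b → X.Adj b c → X.Adj a c → π b c * π a b = π a c)
    (sq : ∀ a b c d, IsSquare X a b c d → π b c * π a b = π d c * π a d) (x₀ : V) :
    ∃ F : V → P, F x₀ = 1 ∧ ∀ a b, X.Adj a b → F b = π a b * F a := by
  choose p hp using fun v => hX.connected.exists_walk_length_eq_dist v x₀
  have hp' : ∀ v, (p v).length = X.dist x₀ v := fun v => by rw [hp, X.dist_comm]
  have up : ∀ a b, X.Adj a b → X.dist x₀ a + 1 = X.dist x₀ b →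
      holonomy π (p b) = π a b * holonomy π (p a) := fun a b hab hd =>
    hX.holonomy_eq π tri sq x₀ _ rfl (p b) (.cons hab.symm (p a)) (hp' b)
      (by rw [SimpleGraph.Walk.length_cons, hp', hd])
  refine ⟨fun v => holonomy π (p v), ?_, fun a b hab => ?_⟩
  · exact hX.holonomy_eq π tri sq x₀ 0 SimpleGraph.dist_self (p x₀) .nil
      (by rw [hp, SimpleGraph.dist_self]) rfl
  · have h₁ := hX.dist_le_succ hab x₀
    have h₂ := hX.dist_le_succ hab.symm x₀
    rcases lt_trichotomy (X.dist x₀ a) (X.dist x₀ b) with h | h | h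
    · exact up a b hab (by omega)
    · obtain ⟨z, hza, hzb, hz⟩ := hX.triangle x₀ a b hab h
      dsimp only
      rw [up z a hza hz, up z b hzb (by omega), ← tri z a b hza hab hzb, mul_assoc]
    · dsimp only
      rw [up b a hab.symm (by omega), ← mul_assoc, inv b a hab.symm, one_mul]

end Potential

section Retract

variable {G V : Type*} [Group G] [MulAction G V] {X : SimpleGraph V} [IsGraphAction G X]

/-- The hypotheses on `π` make `E g = F (g • x₀)` a right action of `G` on `Y` commuting with `H`,
in which each `h` in `H` sends the base point `y₀` to `h • y₀`. The retraction reads off the element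
of `H` by which `k` moves `y₀`. -/
theorem isVirtualRetract_of_perm (hX : IsQuasiMedian X)
    (hfree : ∀ (g : G) (v : V), g • v = v → g = 1) (H : Subgroup G) (Y : SubMulAction H V)
    (hY : IsGated X (Y : Set V)) [Finite (MulAction.orbitRel.Quotient H Y)]
    (π : V → V → Equiv.Perm Y)
    (inv : ∀ a b, X.Adj a b → π b a * π a b = 1)
    (tri : ∀ a b c, X.Adj a b → X.Adj b c → X.Adj a c → π b c * π a b = π a c)
    (sq : ∀ a b c d, IsSquare X a b c d → π b c * π a b = π d c * π a d)
    (smul : ∀ (g : G) (a b : V), X.Adj a b → π (g • a) (g • b) = π a b)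
    (comm : ∀ (h : H) (a b : V) (y : Y), X.Adj a b → π a b (h • y) = h • π a b y)
    (apply_self : ∀ a b : Y, X.Adj (a : V) b → π a b a = b) : IsVirtualRetract H := by
  obtain ⟨x₀, hx₀⟩ := hY.nonempty hX
  obtain ⟨F, hF₀, hF⟩ := hX.exists_potential π inv tri sq x₀
  -- By invariance of `π`, both sides solve the same recursion along edges and agree at `x₀`.
  have hFmul : ∀ (g : G) (v : V), F (g • v) = F v * F (g • x₀) := fun g =>
    hX.adj_induction x₀ (by rw [hF₀, one_mul]) fun a b hab ih => by
      rw [hF _ _ (IsGraphAction.adj_smul g hab), ih, hF a b hab, smul g a b hab, mul_assoc]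
  have hFcomm : ∀ (v : V) (h : H) (y : Y), F v (h • y) = h • F v y :=
    hX.adj_induction x₀ (fun h y => by rw [hF₀]; rfl) fun a b hab ih h y => by
      rw [hF a b hab, Equiv.Perm.mul_apply, ih, comm h a b _ hab, Equiv.Perm.mul_apply]
  let y₀ : Y := ⟨x₀, hx₀⟩
  -- A geodesic from `x₀` to `z` stays in `Y` by convexity, and `apply_self` makes `y₀` follow it.
  have hFY : ∀ (n : ℕ) (z : Y), X.dist x₀ z = n → F z y₀ = z := by
    intro n
    induction n with
    | zero =>
      intro z hz
      have e : y₀ = z := Subtype.ext ((hX.connected.dist_eq_zero_iff).1 hz)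
      subst e
      change F x₀ y₀ = y₀
      rw [hF₀]; rfl
    | succ n ih =>
      intro z hz
      have hne : x₀ ≠ z := by
        intro e
        rw [← e, SimpleGraph.dist_self] at hz
        omega
      obtain ⟨w, hw, hd⟩ := hX.exists_adj_dist hne
      have hwY : w ∈ Y := hY.mem_of_dist hX hx₀ z.2
        (by rw [SimpleGraph.dist_eq_one_iff_adj.2 hw, X.dist_comm (u := w)]; exact hd.symm)
      have e := ih ⟨w, hwY⟩ (by dsimp only; omega)
      rw [hF w z hw, Equiv.Perm.mul_apply, e]
      exact apply_self ⟨w, hwY⟩ z hw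
  let E : G → Equiv.Perm Y := fun g => F (g • x₀)
  have hE : ∀ g g', E (g * g') = E g' * E g := fun g g' => by
    simp only [E]; rw [mul_smul, hFmul]
  have hE₁ : E 1 = 1 := by simp only [E]; rw [one_smul, hF₀]
  have hEH : ∀ h : H, E h y₀ = h • y₀ := fun h => hFY _ (h • y₀) rfl
  have hEcomm : ∀ (g : G) (h : H) (y : Y), E g (h • y) = h • E g y := fun g => hFcomm _
  have hfreeY : ∀ h h' : H, h • y₀ = h' • y₀ → h = h' := fun h h' e => by
    have e' : (h : G) • x₀ = (h' : G) • x₀ := congrArg Subtype.val e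
    have := hfree ((h' : G)⁻¹ * h) x₀ (by rw [mul_smul, e', inv_smul_smul])
    exact Subtype.ext (inv_mul_eq_one.1 this).symm
  let K : Subgroup G :=
    { carrier := {g | ∃ h : H, E g y₀ = h • y₀}
      one_mem' := ⟨1, by rw [hE₁, one_smul]; rfl⟩
      mul_mem' := by
        rintro a b ⟨h, hh⟩ ⟨h', hh'⟩
        exact ⟨h * h', by rw [hE, Equiv.Perm.mul_apply, hh, hEcomm, hh', mul_smul]⟩
      inv_mem' := by
        rintro a ⟨h, hh⟩
        refine ⟨h⁻¹, ?_⟩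
        have e : E a⁻¹ (E a y₀) = y₀ := by
          rw [← Equiv.Perm.mul_apply, ← hE, mul_inv_cancel, hE₁]; rfl
        rw [hh, hEcomm] at e
        rw [← e, inv_smul_smul, e] }
  have hK : ∀ k : K, ∃ h : H, E k y₀ = h • y₀ := fun k => k.2
  choose r hr using hK
  refine ⟨K, fun h hh => ⟨⟨h, hh⟩, hEH ⟨h, hh⟩⟩, ?_, MonoidHom.mk' r fun k k' => ?_, fun h => ?_⟩
  -- Cosets of `K` inject into the `H`-orbits of `Y`; the inverse compensates for `E` reversing
  -- products.
  · have hinj : Function.Injective fun q : G ⧸ K =>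
        (Quotient.mk (MulAction.orbitRel H Y) (E q.out⁻¹ y₀)) := by
      intro q q' e
      obtain ⟨h, hh⟩ := Quotient.exact e
      dsimp only at hh
      rw [← q.out_eq', ← q'.out_eq', QuotientGroup.eq]
      refine ⟨h, ?_⟩
      rw [hE, Equiv.Perm.mul_apply, ← hh, hEcomm, ← Equiv.Perm.mul_apply, ← hE, inv_mul_cancel,
        hE₁]
      rfl
    have : Finite (G ⧸ K) := Finite.of_injective (β := MulAction.orbitRel.Quotient H Y) _ hinj
    exact Subgroup.finiteIndex_of_finite_quotient
  · refine hfreeY _ _ ?_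
    rw [← hr, Subgroup.coe_mul, hE, Equiv.Perm.mul_apply, hr, hEcomm, hr, mul_smul]
  · exact hfreeY _ _ ((hr _).symm.trans (hEH h))

end Retract

/-! ### Special actions and labellings -/

section FreeAction

/-- A set with a free action of `K` carries a group structure for which `K` acts by left
translations. -/
theorem exists_group_of_free {K S : Type*} [Group K] [MulAction K S] [Nonempty S]
    (h : ∀ (k : K) (s : S), k • s = s → k = 1) :
    ∃ _ : Group S, ∀ k : K, ∃ a : S, ∀ s : S, k • s = a * s := by
  have : Nonempty (MulAction.orbitRel.Quotient K S) := ‹Nonempty S›.map (Quotient.mk _)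
  -- Only some group structure on the set of orbits is needed, and the additive group of an
  -- arbitrary ring serves. By freeness, `S` is in bijection with `K × O`, with `K` acting on the
  -- first factor.
  obtain ⟨R⟩ := nonempty_commRing (α := MulAction.orbitRel.Quotient K S)
  let O := Multiplicative (MulAction.orbitRel.Quotient K S)
  let f : K × O → S := fun p => p.1 • Quotient.out p.2.toAdd
  have hf : Function.Bijective f := by
    constructor
    · rintro ⟨k, o⟩ ⟨k', o'⟩ e
      change k • Quotient.out o.toAdd = k' • Quotient.out o'.toAdd at e
      have ho : o.toAdd = o'.toAdd := by
        rw [← Quotient.out_eq o.toAdd, ← Quotient.out_eq o'.toAdd]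
        refine Quotient.sound ⟨k⁻¹ * k', ?_⟩
        dsimp only
        rw [mul_smul, ← e, inv_smul_smul]
      have ho' : o = o' := ho
      subst ho'
      have := h (k'⁻¹ * k) _ (by rw [mul_smul, e, inv_smul_smul])
      rw [inv_mul_eq_one.1 this]
    · intro s
      obtain ⟨k, hk⟩ := Quotient.exact (Quotient.out_eq (Quotient.mk (MulAction.orbitRel K S) s))
      refine ⟨(k⁻¹, Multiplicative.ofAdd (Quotient.mk _ s)), ?_⟩
      exact inv_smul_eq_iff.2 hk.symm
  let e : S ≃ K × O := (Equiv.ofBijective f hf).symm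
  refine ⟨e.group, fun k => ⟨e.symm (k, 1), fun s => ?_⟩⟩
  obtain ⟨⟨k', o⟩, rfl⟩ := e.symm.surjective s
  let _ := e.group
  rw [Equiv.mul_def, Equiv.apply_symm_apply, Equiv.apply_symm_apply, Prod.mk_mul_mk, one_mul]
  exact (mul_smul k k' (Quotient.out o.toAdd)).symm

end FreeAction

/-! ### Consequences of specialness for translates of hyperplanes -/

section Equivariance

variable {G V : Type*} [Group G] [MulAction G V] {X : SimpleGraph V} [IsGraphAction G X]

theorem smul_mem_edges {J : Hyperplane X} (g : G) {x y : V} (h : s(x, y) ∈ J.edges) :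
    s(g • x, g • y) ∈ (g • J).edges := by
  obtain ⟨hadj, rfl⟩ := h
  exact ⟨IsGraphAction.adj_smul (X := X) g hadj, rfl⟩

theorem smul_mem_edges_iff {J : Hyperplane X} (g : G) {x y : V} :
    s(g • x, g • y) ∈ (g • J).edges ↔ s(x, y) ∈ J.edges :=
  ⟨fun h => by simpa using smul_mem_edges g⁻¹ h, smul_mem_edges g⟩

theorem smul_mem_carrier {J : Hyperplane X} (g : G) {y : V} (h : y ∈ J.carrier) :
    g • y ∈ (g • J).carrier := by
  obtain ⟨z, hz⟩ := mem_carrier_iff.1 h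
  exact mem_carrier_iff.2 ⟨g • z, smul_mem_edges g hz⟩

theorem Hyperplane.Transverse.smul {J₁ J₂ : Hyperplane X} (h : J₁.Transverse J₂) (g : G) :
    (g • J₁).Transverse (g • J₂) := by
  obtain ⟨a, b, c, d, hs, h₁, h₂⟩ := h
  exact ⟨_, _, _, _, hs.smul g, smul_mem_edges g h₁, smul_mem_edges g h₂⟩

theorem Hyperplane.Transverse.symm {J₁ J₂ : Hyperplane X} (h : J₁.Transverse J₂) :
    J₂.Transverse J₁ := by
  obtain ⟨a, b, c, d, hs, h₁, h₂⟩ := h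
  exact ⟨a, d, c, b, hs.reflect, h₂, h₁⟩

theorem sectorOf_smul {J : Hyperplane X} (g : G) {u v : V} (h : sectorOf J u = sectorOf J v) :
    sectorOf (g • J) (g • u) = sectorOf (g • J) (g • v) := by
  obtain ⟨p⟩ := SimpleGraph.ConnectedComponent.eq.1 h
  clear h
  induction p with
  | nil => rfl
  | cons hadj _ ih =>
    rw [SimpleGraph.deleteEdges_adj] at hadj
    refine Eq.trans (sectorOf_eq_of_adj (IsGraphAction.adj_smul g hadj.1) ?_) ih
    rw [smul_mem_edges_iff]
    exact hadj.2

theorem sectorOf_smul_iff {J : Hyperplane X} (g : G) {u v : V} :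
    sectorOf (g • J) (g • u) = sectorOf (g • J) (g • v) ↔ sectorOf J u = sectorOf J v := by
  refine ⟨fun h => ?_, sectorOf_smul g⟩
  have := sectorOf_smul g⁻¹ h
  rwa [inv_smul_smul g J, inv_smul_smul, inv_smul_smul] at this

theorem stabilizer_smul_sectorOf {J : Hyperplane X} (g : MulAction.stabilizer G J) (v : V) :
    g • sectorOf J v = sectorOf J (g • v) := rfl

theorem IsHyperplaneSpecial.smul_eq (hG : IsHyperplaneSpecial G X) {J : Hyperplane X} {g : G}
    {y : V} (h : y ∈ J.carrier) (h' : y ∈ (g • J).carrier) : g • J = J := by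
  by_contra hne
  exact hG.not_tangent J g ⟨fun e => hne e.symm, hG.not_transverse J g, y, h, h'⟩

theorem IsHyperplaneSpecial.ne_of_transverse (hG : IsHyperplaneSpecial G X)
    {J₁ J₂ : Hyperplane X} (h : J₁.Transverse J₂) : J₁ ≠ J₂ := by
  rintro rfl
  exact hG.not_transverse J₁ (1 : G) (by rwa [one_smul])

/-- After translating by `g₁⁻¹`, failure of transversality would make `J₁` tangent to a translate of
`J₂`. The two hyperplanes are distinct because no hyperplane is transverse to its own translate. -/
theorem IsHyperplaneSpecial.transverse (hG : IsHyperplaneSpecial G X) {J₁ J₂ : Hyperplane X}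
    (h : J₁.Transverse J₂) {g₁ g₂ : G} {y : V} (h₁ : y ∈ (g₁ • J₁).carrier)
    (h₂ : y ∈ (g₂ • J₂).carrier) : (g₁ • J₁).Transverse (g₂ • J₂) := by
  have e₁ : g₁⁻¹ • y ∈ J₁.carrier := by simpa using smul_mem_carrier g₁⁻¹ h₁
  have e₂ : g₁⁻¹ • y ∈ ((g₁⁻¹ * g₂) • J₂).carrier := by
    rw [mul_smul]
    exact smul_mem_carrier g₁⁻¹ h₂
  have ne : J₁ ≠ (g₁⁻¹ * g₂) • J₂ := fun e =>
    hG.not_transverse J₁ (g₁⁻¹ * g₂)⁻¹ (by rwa [← inv_smul_eq_iff.2 e] at h)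
  have ht : J₁.Transverse ((g₁⁻¹ * g₂) • J₂) := by
    by_contra hn
    exact hG.not_inter_osculating J₁ J₂ (g₁⁻¹ * g₂) h ⟨ne, hn, _, e₁, e₂⟩
  have := ht.smul g₁
  rwa [mul_smul, smul_inv_smul] at this

theorem IsSpecial.smul_sector_eq (hG : IsSpecial G X) {J : Hyperplane X}
    {g : MulAction.stabilizer G J} {S : J.Sector} (h : g • S = S) (T : J.Sector) : g • T = T := by
  have := hG.free J (MulAction.toPermHom _ J.Sector g) ⟨g, rfl⟩ S h
  exact congrArg (fun σ : Equiv.Perm J.Sector => σ T) this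

/-- Special actions are free on vertices. -/
theorem IsSpecial.eq_one_of_smul_eq (hX : IsQuasiMedian X) (hG : IsSpecial G X) {g : G} {v : V}
    (h : g • v = v) : g = 1 := by
  have key : ∀ u : V, g • u = u := by
    refine hX.adj_induction v h fun a b hab ha => ?_
    have hJ := mem_edges_mk hab
    generalize (Hyperplane.mk (⟨s(a, b), hab⟩ : X.edgeSet)) = J at hJ
    have hgJ := smul_mem_edges g hJ
    rw [ha] at hgJ
    have e : g • J = J := hG.smul_eq (mem_carrier_iff.2 ⟨b, hJ⟩) (mem_carrier_iff.2 ⟨_, hgJ⟩)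
    rw [e] at hgJ
    refine eq_of_sectorOf_eq hX hgJ hJ ?_
    have fix : (⟨g, e⟩ : MulAction.stabilizer G J) • sectorOf J a = sectorOf J a :=
      congrArg (sectorOf J) ha
    exact hG.smul_sector_eq fix (sectorOf J b)
  have := hG.faithful
  exact FaithfulSMul.eq_of_smul_eq_smul (α := V) fun u => by rw [key u, one_smul]

theorem IsSpecial.exists_group_sector [Nonempty V] (hG : IsSpecial G X) (J : Hyperplane X) :
    ∃ _ : Group J.Sector, ∀ g : MulAction.stabilizer G J, ∃ a : J.Sector, ∀ S, g • S = a * S := by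
  have : Nonempty J.Sector := ‹Nonempty V›.map (sectorOf J)
  obtain ⟨gr, h⟩ := exists_group_of_free (K := sectorGroup G J) (S := J.Sector)
    fun k S hS => Subtype.ext (hG.free J k k.2 S hS)
  exact ⟨gr, fun g => h ⟨MulAction.toPermHom _ J.Sector g, ⟨g, rfl⟩⟩⟩

end Equivariance

/-! ### Invariant labels for pairs of sectors -/

section Labelling

universe u

variable {V : Type u}

/-- An invariant labelling of the pairs of sectors delimited by the hyperplanes of `X` by elements
of a group `Λ`. -/
structure Labelling (G : Type*) [Group G] [MulAction G V] (X : SimpleGraph V) [IsGraphAction G X]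
    (Λ : Type*) [Group Λ] where
  label : Hyperplane X → V → V → Λ
  mul_eq : ∀ J u v w, label J u v * label J v w = label J u w
  eq_one_iff : ∀ J u v, label J u v = 1 ↔ sectorOf J u = sectorOf J v
  smul_eq : ∀ (g : G) J u v, label (g • J) (g • u) (g • v) = label J u v
  exists_eq : ∀ J u v y, ∃ z, label J y z = label J u v

variable {G : Type*} [Group G] [MulAction G V] {X : SimpleGraph V} [IsGraphAction G X]

/-- Sectors of `J` are carried to those of the orbit representative, where they are group elements.
The carrying element is unique only up to the stabiliser, which acts by left translations; these
cancel in `β(u)⁻¹ * β(v)`. A product over the orbits puts all labels in one group. -/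
theorem IsSpecial.exists_labelling [Nonempty V] (hG : IsSpecial G X) :
    ∃ (Λ : Type u) (_ : Group Λ), Nonempty (Labelling G X Λ) := by
  classical
  let c : Hyperplane X → MulAction.orbitRel.Quotient G (Hyperplane X) := Quotient.mk _
  have hc : ∀ (g : G) (J : Hyperplane X), c (g • J) = c J := fun g J => Quotient.sound ⟨g, rfl⟩
  choose gr hgr using fun d : MulAction.orbitRel.Quotient G (Hyperplane X) =>
    hG.exists_group_sector d.out
  have ht : ∀ J : Hyperplane X, ∃ g : G, g • (c J).out = J := fun J =>
    Quotient.exact (Quotient.out_eq (c J)).symm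
  choose t ht using ht
  let Λ := ∀ d : MulAction.orbitRel.Quotient G (Hyperplane X), d.out.Sector
  let β (d : MulAction.orbitRel.Quotient G (Hyperplane X)) (g : G) (v : V) : Λ :=
    Pi.mulSingle d (sectorOf d.out (g⁻¹ • v))
  have hβ : ∀ d (g₁ g₂ : G), g₁ • d.out = g₂ • d.out → ∃ κ, ∀ v, β d g₁ v = κ * β d g₂ v := by
    intro d g₁ g₂ e
    obtain ⟨a, ha⟩ := hgr d ⟨g₁⁻¹ * g₂, by
      rw [MulAction.mem_stabilizer_iff, mul_smul, ← e, inv_smul_smul]⟩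
    refine ⟨Pi.mulSingle d a, fun v => ?_⟩
    simp only [β]
    rw [← Pi.mulSingle_mul, ← ha, stabilizer_smul_sectorOf, Subgroup.smul_def, smul_smul,
      mul_assoc, mul_inv_cancel, mul_one]
  refine ⟨Λ, inferInstance, ⟨⟨fun J u v => (β (c J) (t J) u)⁻¹ * β (c J) (t J) v, ?_, ?_, ?_, ?_⟩⟩⟩
  · intro J u v w
    rw [mul_assoc, mul_inv_cancel_left]
  · intro J u v
    rw [inv_mul_eq_one, (Pi.mulSingle_injective (c J)).eq_iff]
    have := sectorOf_smul_iff (J := (c J).out) (t J) (u := (t J)⁻¹ • u) (v := (t J)⁻¹ • v)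
    rw [ht, smul_inv_smul, smul_inv_smul] at this
    exact this.symm
  · intro g J u v
    obtain ⟨κ, hκ⟩ := hβ (c J) (g⁻¹ * t (g • J)) (t J) (by
      rw [ht, mul_smul, ← hc g J, ht, inv_smul_smul])
    have e : ∀ v, β (c (g • J)) (t (g • J)) (g • v) = κ * β (c J) (t J) v := fun v => by
      rw [← hκ, hc]
      simp only [β]
      rw [mul_inv_rev, inv_inv, mul_smul]
    rw [e, e, mul_inv_rev, mul_assoc, inv_mul_cancel_left]
  · intro J u v y
    obtain ⟨w, hw⟩ := sectorOf_surjective (c J).out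
      (sectorOf _ ((t J)⁻¹ • y) * ((sectorOf _ ((t J)⁻¹ • u))⁻¹ * sectorOf _ ((t J)⁻¹ • v)))
    refine ⟨t J • w, ?_⟩
    simp only [β]
    rw [inv_smul_smul, hw, Pi.mulSingle_mul, Pi.mulSingle_mul, Pi.mulSingle_inv,
      inv_mul_cancel_left]

end Labelling

/-! ### The canonical completion of a gated subgraph -/

section Completion

variable {G V Λ : Type*} [Group G] [MulAction G V] {X : SimpleGraph V} [IsGraphAction G X]
  [Group Λ]

namespace Labelling

variable (L : Labelling G X Λ)

theorem label_self (J : Hyperplane X) (u : V) : L.label J u u = 1 :=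
  (L.eq_one_iff J u u).2 rfl

theorem label_congr {J : Hyperplane X} {u v u' v' : V} (h : sectorOf J u = sectorOf J u')
    (h' : sectorOf J v = sectorOf J v') : L.label J u v = L.label J u' v' := by
  rw [← L.mul_eq J u u' v, (L.eq_one_iff J u u').2 h, one_mul, ← L.mul_eq J u' v' v,
    (L.eq_one_iff J v' v).2 h'.symm, mul_one]

end Labelling

variable {H : Subgroup G} {Y : SubMulAction H V}

/-- Some hyperplane in the orbit of `J` is dual to an edge of `Y` at `y`. -/
def Movable (J : Hyperplane X) (y : Y) : Prop :=
  ∃ (g : G) (w : Y), s((y : V), (w : V)) ∈ (g • J).edges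

/-- Some hyperplane in the orbit of `J` is dual to an edge of `Y` at `y`, and `z` is obtained
from `y` by crossing this hyperplane with the label `t`, possibly trivial. -/
def Moves (L : Labelling G X Λ) (J : Hyperplane X) (t : Λ) (y z : Y) : Prop :=
  ∃ (g : G) (w : Y), s((y : V), (w : V)) ∈ (g • J).edges ∧
    (y = z ∨ s((y : V), (z : V)) ∈ (g • J).edges) ∧ L.label (g • J) y z = t

open Classical in
/-- Crossing the hyperplane of `Y` at `y` in the orbit of `J` with the label `t` if there is such a
hyperplane, and staying at `y` otherwise. -/
noncomputable def move (L : Labelling G X Λ) (J : Hyperplane X) (t : Λ) (y : Y) : Y :=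
  if h : ∃ z, Moves L J t y z then h.choose else y

variable {L : Labelling G X Λ} {J : Hyperplane X} {t : Λ} {y z : Y}

theorem Moves.movable (h : Moves L J t y z) : Movable (G := G) J y := by
  obtain ⟨g, w, hw, -⟩ := h
  exact ⟨g, w, hw⟩

theorem Moves.movable_right (h : Moves L J t y z) : Movable (G := G) J z := by
  obtain ⟨g, w, hw, rfl | hz, -⟩ := h
  exacts [⟨g, w, hw⟩, ⟨g, y, mem_edges_swap hz⟩]

theorem moves_of_mem_edges {g : G} (h : s((y : V), (z : V)) ∈ (g • J).edges) :
    Moves L J (L.label (g • J) y z) y z :=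
  ⟨g, z, h, .inr h, rfl⟩

theorem IsHyperplaneSpecial.smul_eq_smul (hG : IsHyperplaneSpecial G X) {g g' : G} {y : V}
    (h : y ∈ (g • J).carrier) (h' : y ∈ (g' • J).carrier) : g • J = g' • J := by
  have := hG.smul_eq (J := g • J) (g := g' * g⁻¹) h (by rwa [mul_smul, inv_smul_smul])
  rwa [mul_smul, inv_smul_smul, eq_comm] at this

/-- Only one hyperplane in the orbit has `y` in its carrier; the label fixes the target sector,
which contains at most one neighbour of `y` across that hyperplane. -/
theorem Moves.unique (hX : IsQuasiMedian X) (hG : IsSpecial G X) {z' : Y} (h : Moves L J t y z)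
    (h' : Moves L J t y z') : z = z' := by
  obtain ⟨g, w, hw, hz, e⟩ := h
  obtain ⟨g', w', hw', hz', e'⟩ := h'
  rw [← hG.smul_eq_smul (mem_carrier_iff.2 ⟨_, hw⟩) (mem_carrier_iff.2 ⟨_, hw'⟩)] at hz' e'
  have hs : sectorOf (g • J) (z : V) = sectorOf (g • J) z' := by
    rw [← L.eq_one_iff, ← mul_right_inj, L.mul_eq, e', mul_one, e]
  rcases hz with rfl | hz <;> rcases hz' with rfl | hz'
  · rfl
  · exact absurd hs (sectorOf_ne hX hz')
  · exact absurd hs.symm (sectorOf_ne hX hz)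
  · exact Subtype.ext (eq_of_sectorOf_eq hX hz hz' hs)

theorem Movable.exists_moves (hX : IsQuasiMedian X) (hY : IsGated X (Y : Set V))
    (h : Movable (G := G) J y) (u v : V) : ∃ z, Moves L J (L.label J u v) y z := by
  obtain ⟨g, w, hw⟩ := h
  obtain ⟨z, hz⟩ := L.exists_eq (g • J) (g • u) (g • v) y
  rw [L.smul_eq] at hz
  by_cases hyz : sectorOf (g • J) (y : V) = sectorOf (g • J) z
  · refine ⟨y, g, w, hw, .inl rfl, ?_⟩
    rw [← hz]
    exact L.label_congr rfl hyz
  · obtain ⟨z', hz', e⟩ := exists_mem_edges_sectorOf hX (mem_carrier_iff.2 ⟨_, hw⟩) hyz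
    -- If `z'` differs from `w`, it forms a triangle with the edge from `y` to `w`, and gatedness
    -- keeps it in `Y`.
    have hmem : z' ∈ Y := by
      by_cases hwz : z' = w
      · exact hwz ▸ w.2
      · exact hY.mem_of_adj hX y.2 w.2 (adj_of_mem_edges hw).ne (adj_of_mem_edges hz').symm
          (adj_of_mem_edges_of_mem_edges hX hz' hw hwz)
    exact ⟨⟨z', hmem⟩, g, w, hw, .inr hz', by rw [← hz]; exact L.label_congr rfl e⟩

theorem Moves.move_eq (hX : IsQuasiMedian X) (hG : IsSpecial G X) (h : Moves L J t y z) :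
    move L J t y = z := by
  rw [move, dif_pos ⟨z, h⟩]
  exact (Exists.choose_spec (⟨z, h⟩ : ∃ z, Moves L J t y z)).unique hX hG h

theorem move_of_not_movable (h : ¬ Movable (G := G) J y) : move L J t y = y :=
  dif_neg fun ⟨_, hz⟩ => h hz.movable

theorem Moves.trans (hX : IsQuasiMedian X) (hG : IsSpecial G X) {t' : Λ} {z' : Y}
    (h : Moves L J t y z) (h' : Moves L J t' z z') : Moves L J (t * t') y z' := by
  obtain ⟨g, w, hw, hz, rfl⟩ := h
  obtain ⟨g', w', hw', hz', rfl⟩ := h'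
  have hzc : (z : V) ∈ (g • J).carrier := by
    rcases hz with rfl | hz
    exacts [mem_carrier_iff.2 ⟨_, hw⟩, mem_carrier_iff.2 ⟨_, mem_edges_swap hz⟩]
  rw [← hG.smul_eq_smul hzc (mem_carrier_iff.2 ⟨_, hw'⟩)] at hz' ⊢
  refine ⟨g, w, hw, ?_, (L.mul_eq _ _ _ _).symm⟩
  rcases hz with rfl | hz
  · exact hz'
  rcases hz' with rfl | hz'
  · exact .inr hz
  by_cases hyz : y = z'
  · exact .inl hyz
  · exact .inr (mem_edges_of_common_vertex hX (mem_edges_swap hz) hz'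
      fun e => hyz (Subtype.ext e))

theorem move_move (hX : IsQuasiMedian X) (hG : IsSpecial G X) (hY : IsGated X (Y : Set V))
    (J : Hyperplane X) (u v w : V) (y : Y) :
    move L J (L.label J v w) (move L J (L.label J u v) y) = move L J (L.label J u w) y := by
  by_cases h : Movable (G := G) J y
  · obtain ⟨z, hz⟩ := h.exists_moves (L := L) hX hY u v
    obtain ⟨z', hz'⟩ := hz.movable_right.exists_moves (L := L) hX hY v w
    have := hz.trans hX hG hz'
    rw [L.mul_eq] at this
    rw [hz.move_eq hX hG, hz'.move_eq hX hG, this.move_eq hX hG]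
  · rw [move_of_not_movable h, move_of_not_movable h, move_of_not_movable h]

theorem move_one (hX : IsQuasiMedian X) (hG : IsSpecial G X) (J : Hyperplane X) (y : Y) :
    move L J 1 y = y := by
  by_cases h : Movable (G := G) J y
  · obtain ⟨g, w, hw⟩ := h
    exact Moves.move_eq hX hG ⟨g, w, hw, .inl rfl, L.label_self _ _⟩
  · exact move_of_not_movable h

theorem exists_square_of_transverse (hX : IsQuasiMedian X) (hG : IsSpecial G X)
    (hY : IsGated X (Y : Set V)) {J₁ J₂ : Hyperplane X} (hT : J₁.Transverse J₂) {g₁ g₂ : G}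
    {y u v : Y} (hu : s((y : V), (u : V)) ∈ (g₁ • J₁).edges)
    (hv : s((y : V), (v : V)) ∈ (g₂ • J₂).edges) :
    ∃ z : Y, IsSquare X (y : V) u z v ∧ g₁ • J₁ ≠ g₂ • J₂ := by
  have hT' := hG.transverse hT (mem_carrier_iff.2 ⟨_, hu⟩) (mem_carrier_iff.2 ⟨_, hv⟩)
  have hne := hG.ne_of_transverse hT'
  obtain ⟨z, hz⟩ := hT'.exists_square hX hne hu hv
  exact ⟨⟨z, hY.mem_of_adj hX u.2 v.2 hz.ne_bd hz.bc.symm hz.cd⟩, hz, hne⟩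

/-- The `J₂`-edge at `z` and the `J₁`-edge from `z` to `y` span a square inside `Y`, whose opposite
side is a `J₂`-edge at `y`. -/
theorem Movable.of_move (hX : IsQuasiMedian X) (hG : IsSpecial G X)
    (hY : IsGated X (Y : Set V)) {J₁ J₂ : Hyperplane X} (hT : J₁.Transverse J₂)
    (h₂ : Movable (G := G) J₂ z) (h : Moves L J₁ t y z) : Movable (G := G) J₂ y := by
  obtain ⟨g, w, hw, rfl | hz, -⟩ := h
  · exact h₂
  obtain ⟨g₂, w₂, hw₂⟩ := h₂
  obtain ⟨x, hx, -⟩ := exists_square_of_transverse hX hG hY hT (mem_edges_swap hz) hw₂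
  exact ⟨g₂, x, hx.reflect.mem_edges hw₂⟩

/-- When both motions are non-trivial, they are the two ways around a square of `Y`. When only one
hyperplane orbit is available at `y`, `Movable.of_move` shows that the other is still unavailable
after moving. -/
theorem move_comm (hX : IsQuasiMedian X) (hG : IsSpecial G X) (hY : IsGated X (Y : Set V))
    {J₁ J₂ : Hyperplane X} (hT : J₁.Transverse J₂) (a b c d : V) (y : Y) :
    move L J₁ (L.label J₁ a b) (move L J₂ (L.label J₂ c d) y) =
      move L J₂ (L.label J₂ c d) (move L J₁ (L.label J₁ a b) y) := by
  have one_side : ∀ {J₁ J₂ : Hyperplane X}, J₁.Transverse J₂ → ∀ a b c d : V,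
      Movable (G := G) J₁ y → ¬ Movable (G := G) J₂ y →
      move L J₁ (L.label J₁ a b) (move L J₂ (L.label J₂ c d) y) =
        move L J₂ (L.label J₂ c d) (move L J₁ (L.label J₁ a b) y) := by
    intro J₁ J₂ hT a b c d h₁ h₂
    obtain ⟨z, hz⟩ := h₁.exists_moves (L := L) hX hY a b
    rw [move_of_not_movable h₂, hz.move_eq hX hG,
      move_of_not_movable fun h => h₂ (h.of_move hX hG hY hT hz)]
  by_cases h₁ : Movable (G := G) J₁ y <;> by_cases h₂ : Movable (G := G) J₂ y
  · obtain ⟨u, hu⟩ := h₁.exists_moves (L := L) hX hY a b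
    obtain ⟨v, hv⟩ := h₂.exists_moves (L := L) hX hY c d
    rw [hu.move_eq hX hG, hv.move_eq hX hG]
    obtain ⟨g₁, w₁, hw₁, rfl | hyu, e₁⟩ := hu
    · rw [L.label_self] at e₁
      rw [← e₁, move_one hX hG, hv.move_eq hX hG]
    obtain ⟨g₂, w₂, hw₂, rfl | hyv, e₂⟩ := hv
    · rw [L.label_self] at e₂
      rw [← e₂, move_one hX hG, Moves.move_eq hX hG ⟨g₁, w₁, hw₁, .inr hyu, e₁⟩]
    obtain ⟨z, hz, hne⟩ := exists_square_of_transverse hX hG hY hT hyu hyv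
    have m₁ : Moves L J₁ (L.label J₁ a b) v z := by
      have hm := hz.mem_edges hyu
      refine ⟨g₁, z, hm, .inr hm, ?_⟩
      rw [← e₁]
      refine L.label_congr (sectorOf_eq_of_adj hz.da fun h => ?_)
        (sectorOf_eq_of_adj hz.bc.symm fun h => ?_)
      · exact hne (eq_of_mem_edges (mem_edges_swap h) hyv)
      · exact hne (eq_of_mem_edges (mem_edges_swap h) (hz.reflect.mem_edges hyv))
    have m₂ : Moves L J₂ (L.label J₂ c d) u z := by
      have hm := hz.reflect.mem_edges hyv
      refine ⟨g₂, z, hm, .inr hm, ?_⟩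
      rw [← e₂]
      refine L.label_congr (sectorOf_eq_of_adj hz.ab.symm fun h => ?_)
        (sectorOf_eq_of_adj hz.cd fun h => ?_)
      · exact hne (eq_of_mem_edges hyu (mem_edges_swap h))
      · exact hne (eq_of_mem_edges (hz.mem_edges hyu) (mem_edges_swap h))
    rw [m₁.move_eq hX hG, m₂.move_eq hX hG]
  · exact one_side hT a b c d h₁ h₂
  · exact (one_side hT.symm c d a b h₂ h₁).symm
  · rw [move_of_not_movable h₂, move_of_not_movable h₁, move_of_not_movable h₂]

theorem moves_smul_iff (g : G) : Moves L (g • J) t y z ↔ Moves L J t y z := by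
  constructor
  · rintro ⟨g', w, h⟩
    rw [smul_smul] at h
    exact ⟨g' * g, w, h⟩
  · rintro ⟨g', w, h⟩
    refine ⟨g' * g⁻¹, w, ?_⟩
    rwa [smul_smul, inv_mul_cancel_right]

theorem move_smul (g : G) : move L (g • J) t y = move L J t y := by
  have h : Moves L (g • J) t y = Moves L J t y := funext fun _ => propext (moves_smul_iff g)
  rw [move, move, h]

theorem Moves.smul (h : H) (hm : Moves L J t y z) : Moves L J t (h • y) (h • z) := by
  obtain ⟨g, w, hw, hz, rfl⟩ := hm
  refine ⟨h * g, h • w, ?_, ?_, ?_⟩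
  · rw [mul_smul]
    exact smul_mem_edges (h : G) hw
  · rw [mul_smul]
    exact hz.imp (congrArg (h • ·)) (smul_mem_edges (h : G))
  · rw [mul_smul]
    exact L.smul_eq (h : G) (g • J) y z

theorem move_smul_apply (hX : IsQuasiMedian X) (hG : IsSpecial G X) (h : H) :
    move L J t (h • y) = h • move L J t y := by
  by_cases hm : ∃ z, Moves L J t y z
  · obtain ⟨z, hz⟩ := hm
    rw [hz.move_eq hX hG, (hz.smul h).move_eq hX hG]
  · have hm' : ¬ ∃ z, Moves L J t (h • y) z := fun ⟨z, hz⟩ =>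
      hm ⟨h⁻¹ • z, by simpa using hz.smul h⁻¹⟩
    rw [move, dif_neg hm', move, dif_neg hm]

variable (L Y) in
/-- The permutation of `Y` given by moving along the label of the pair `(u, v)`. -/
noncomputable def movePerm (hX : IsQuasiMedian X) (hG : IsSpecial G X)
    (hY : IsGated X (Y : Set V)) (J : Hyperplane X) (u v : V) : Equiv.Perm Y where
  toFun := move L J (L.label J u v)
  invFun := move L J (L.label J v u)
  left_inv y := by rw [move_move hX hG hY, L.label_self, move_one hX hG]
  right_inv y := by rw [move_move hX hG hY, L.label_self, move_one hX hG]

open Classical in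
theorem IsSpecial.isVirtualRetract (hX : IsQuasiMedian X) (hG : IsSpecial G X)
    (hY : IsGated X (Y : Set V)) [Finite (MulAction.orbitRel.Quotient H Y)] :
    IsVirtualRetract H := by
  have := hX.connected.nonempty
  obtain ⟨Λ, _, ⟨L⟩⟩ := hG.exists_labelling
  -- The value on non-adjacent pairs is a default that plays no role.
  let π : V → V → Equiv.Perm Y := fun a b =>
    if h : X.Adj a b then movePerm Y L hX hG hY (Hyperplane.mk ⟨s(a, b), h⟩) a b else 1
  have hπ : ∀ {J : Hyperplane X} {a b : V} (y : Y), s(a, b) ∈ J.edges →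
      π a b y = move L J (L.label J a b) y := by
    rintro J a b y ⟨hab, rfl⟩
    simp only [π]
    rw [dif_pos (show X.Adj a b from hab)]
    rfl
  refine isVirtualRetract_of_perm hX (fun g v => hG.eq_one_of_smul_eq hX) H Y hY π ?_ ?_ ?_ ?_ ?_ ?_
  · intro a b hab
    ext1 y
    have hJ := mem_edges_mk hab
    rw [Equiv.Perm.mul_apply, hπ _ hJ, hπ _ (mem_edges_swap hJ), move_move hX hG hY, L.label_self,
      move_one hX hG]
    rfl
  · intro a b c hab hbc hac
    ext1 y
    have hJ := mem_edges_mk hab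
    have hJ' := mem_edges_of_triangle hJ hbc hac
    have hJ'' := mem_edges_of_triangle (mem_edges_swap hJ) hac hbc
    rw [Equiv.Perm.mul_apply, hπ _ hJ, hπ _ hJ', hπ _ hJ'', move_move hX hG hY]
  · intro a b c d hs
    ext1 y
    have hJ₁ := mem_edges_mk hs.ab
    have hJ₂ := mem_edges_mk hs.da.symm
    generalize Hyperplane.mk (⟨s(a, b), hs.ab⟩ : X.edgeSet) = J₁ at hJ₁
    generalize Hyperplane.mk (⟨s(a, d), hs.da.symm⟩ : X.edgeSet) = J₂ at hJ₂
    have hT : J₁.Transverse J₂ := ⟨a, b, c, d, hs, hJ₁, hJ₂⟩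
    have hne := hG.ne_of_transverse hT
    have hJ₁' := hs.mem_edges hJ₁
    have hJ₂' := hs.reflect.mem_edges hJ₂
    -- Opposite sides of a square carry equal labels, since the remaining sides do not cross their
    -- hyperplane.
    have e₁ : L.label J₁ d c = L.label J₁ a b := L.label_congr
      (sectorOf_eq_of_adj hs.da fun h => hne (eq_of_mem_edges (mem_edges_swap h) hJ₂))
      (sectorOf_eq_of_adj hs.bc.symm fun h => hne (eq_of_mem_edges (mem_edges_swap h) hJ₂'))
    have e₂ : L.label J₂ b c = L.label J₂ a d := L.label_congr
      (sectorOf_eq_of_adj hs.ab.symm fun h => hne (eq_of_mem_edges hJ₁ (mem_edges_swap h)))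
      (sectorOf_eq_of_adj hs.cd fun h => hne (eq_of_mem_edges hJ₁' (mem_edges_swap h)))
    rw [Equiv.Perm.mul_apply, Equiv.Perm.mul_apply, hπ _ hJ₁, hπ _ hJ₂, hπ _ hJ₁', hπ _ hJ₂',
      e₁, e₂, move_comm hX hG hY hT]
  · intro g a b hab
    ext1 y
    have hJ := mem_edges_mk hab
    rw [hπ _ hJ, hπ _ (smul_mem_edges g hJ), L.smul_eq, move_smul]
  · intro h a b y hab
    have hJ := mem_edges_mk hab
    rw [hπ _ hJ, hπ _ hJ, move_smul_apply hX hG]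
  · intro a b hab
    have hJ := mem_edges_mk hab
    rw [hπ _ hJ]
    have hm := moves_of_mem_edges (L := L) (g := 1) (by rwa [one_smul])
    rw [one_smul] at hm
    exact hm.move_eq hX hG

end Completion

end QuasiMedian

theorem mainTheorem6 {G V : Type*} [Group G] [MulAction G V] (X : SimpleGraph V)
    [QuasiMedian.IsGraphAction G X] (hX : QuasiMedian.IsQuasiMedian X)
    (hG : QuasiMedian.IsSpecial G X) (hfin : Finite (MulAction.orbitRel.Quotient G V))
    (H : Subgroup G) (hH : QuasiMedian.IsGatedCocompact X H) :
    QuasiMedian.IsVirtualRetract H := by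
  obtain ⟨Y, hY, hfinY⟩ := hH
  exact hG.isVirtualRetract hX hY
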